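/- Let $k$ be a field of characteristic zero, $\bar k$ an algebraic closure of $k$, $E$ an elliptic curve over $k$ (given by a Weierstrass equation) with origin $O$, and $E[2]$ the group of $2$-torsion points of $E(\bar k)$. Let $f : E \to E$ be an isogeny (a nonconstant morphism of $E_{\bar k}$ with $f(O)=O$) of degree $d = [\bar k(E) : f^*\bar k(E)]$, with kernel $\mathrm{Ker}(f)=\{P\in E(\bar k) : f(P)=O\}$. Let $f^*(O)=\sum_{f(P)=O} e_f(P)\,(P)$ be the pullback of the divisor $(O)$, where $e_f(P)$ is the ramification index of $f$ at $P$, and let $\sim$ denote linear equivalence of divisors on $E_{\bar k}$, i.e. $D\sim D'$ if and only if $D-D'=\mathrm{div}(g)$ for some $g\in\bar k(E)^{\times}$. Then $$\mathrm{Card}\big(E[2]\cap \mathrm{Ker}(f)\big)\neq 2 \iff f^*(O)\sim d\,(O).$$ If moreover $f$ is defined over $k$, the same equivalence holds with $\sim$ replaced by linear equivalence over $k$ (that is, with $g\in k(E)^{\times}$). -/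

import Mathlib

namespace EllipticIsogeny

open WeierstrassCurve Polynomial

noncomputable section

/-! ### Rational functions on a Weierstrass curve over a field `K`

The notions below are the usual ones when `K` is algebraically closed; then the points of the curve
are the elements of `W.Point`, and `W.FunctionField` is the field of rational functions. -/

section Curve

variable {K : Type*} [Field K] (W : Affine K)

/-- The coordinate function `x`. -/
def xFun : W.FunctionField :=
  algebraMap W.CoordinateRing W.FunctionField (Affine.CoordinateRing.mk W (C X))

/-- The coordinate function `y`. -/
def yFun : W.FunctionField :=
  algebraMap W.CoordinateRing W.FunctionField (Affine.CoordinateRing.mk W X)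

variable {W}

/-- Homogeneous coordinates of a point: `[0 : 1 : 0]` for the point at infinity `O`, and
`[x : y : 1]` for an affine point. -/
def projCoords : W.Point → Fin 3 → K
  | .zero => ![0, 1, 0]
  | .some x y _ => ![x, y, 1]

/-- The rational function `g` is regular at `P` with value `g(P) = c`: it is a quotient `A / B` of
two homogeneous polynomials of the same degree such that `B(P) ≠ 0` and `A(P) / B(P) = c`. -/
def HasValueAt (P : W.Point) (g : W.FunctionField) (c : K) : Prop :=
  ∃ (n : ℕ) (A B : MvPolynomial (Fin 3) K), A.IsHomogeneous n ∧ B.IsHomogeneous n ∧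
    MvPolynomial.eval (projCoords P) B ≠ 0 ∧
    g = MvPolynomial.aeval ![xFun W, yFun W, 1] A / MvPolynomial.aeval ![xFun W, yFun W, 1] B ∧
    c = MvPolynomial.eval (projCoords P) A / MvPolynomial.eval (projCoords P) B

/-- The rational function `g` is regular at `P`, i.e. it lies in the local ring at `P`. -/
def RegularAt (P : W.Point) (g : W.FunctionField) : Prop :=
  ∃ c : K, HasValueAt P g c

/-- `t` generates the maximal ideal of the local ring at `P`. -/
def IsUniformizer (P : W.Point) (t : W.FunctionField) : Prop :=
  t ≠ 0 ∧ HasValueAt P t 0 ∧ ∀ g, HasValueAt P g 0 → RegularAt P (g / t)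

/-- The order of vanishing at `P` of a nonzero rational function `g` on a nonsingular curve: the
largest integer `n` such that `g / t ^ n` is regular at `P`, where `t` is a uniformizer at `P`. -/
def ord (P : W.Point) (g : W.FunctionField) : ℤ :=
  sSup {n : ℤ | ∃ t, IsUniformizer P t ∧ RegularAt P (g / t ^ n)}

variable (W) in
/-- The group of divisors. The divisor `(P)` is `Finsupp.single P 1`. -/
abbrev Divisor : Type _ := W.Point →₀ ℤ

/-- The divisor of the nonzero rational function `g` is `D`. -/
def IsDivisorOf (g : W.FunctionField) (D : Divisor W) : Prop :=
  g ≠ 0 ∧ ∀ P, ord P g = D P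

/-- Linear equivalence of divisors. -/
def LinEquiv (D D' : Divisor W) : Prop :=
  ∃ g : W.FunctionField, IsDivisorOf g (D - D')

end Curve

/-! ### Isogenies -/

/-- An isogeny `W₁ → W₂` (`K` algebraically closed): a nonconstant morphism that maps `O` to `O`.
The morphism is given by its effect on points together with its (injective) comorphism on function
fields: a function that is regular at `f(P)` is pulled back to a function that is regular at `P`
and has there the same value. -/
structure Isogeny {K : Type*} [Field K] (W₁ W₂ : Affine K) where
  toFun : W₁.Point → W₂.Point
  comap : W₂.FunctionField →ₐ[K] W₁.FunctionField
  hasValueAt_comap : ∀ (P : W₁.Point) (g : W₂.FunctionField) (c : K),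
    HasValueAt (toFun P) g c → HasValueAt P (comap g) c
  map_zero : toFun 0 = 0

section Finiteness

/-! Fibres of isogenies are finite, so that the pullback of a divisor is a divisor. -/

variable {K : Type*} [Field K] {W : Affine K}

lemma aeval_xy (A : MvPolynomial (Fin 3) K) :
    MvPolynomial.aeval ![xFun W, yFun W, 1] A = algebraMap W.CoordinateRing W.FunctionField
      (Affine.CoordinateRing.mk W (MvPolynomial.aeval ![C X, X, 1] A)) := by
  induction A using MvPolynomial.induction_on with
  | C a => rw [MvPolynomial.aeval_C, MvPolynomial.aeval_C]; rfl
  | add p q hp hq => simp only [map_add, hp, hq]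
  | mul_X p i hp =>
    rw [map_mul, hp, map_mul, map_mul, map_mul, MvPolynomial.aeval_X, MvPolynomial.aeval_X]
    fin_cases i <;> simp [xFun, yFun]

lemma evalEval_aeval (x y : K) (A : MvPolynomial (Fin 3) K) :
    (MvPolynomial.aeval ![C X, X, 1] A : K[X][X]).evalEval x y =
      MvPolynomial.eval ![x, y, 1] A := by
  induction A using MvPolynomial.induction_on with
  | C a =>
    rw [MvPolynomial.aeval_C, MvPolynomial.eval_C]
    exact evalEval_CC x y a
  | add p q hp hq => simp only [map_add, evalEval_add, hp, hq]
  | mul_X p i hp =>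
    rw [map_mul, map_mul, evalEval_mul, hp, MvPolynomial.aeval_X, MvPolynomial.eval_X]
    fin_cases i <;> simp [evalEval]

lemma evalEval_eq_of_mk_eq {x y : K} (h : W.Equation x y) {p q : K[X][X]}
    (hpq : Affine.CoordinateRing.mk W p = Affine.CoordinateRing.mk W q) :
    p.evalEval x y = q.evalEval x y := by
  obtain ⟨r, hr⟩ := AdjoinRoot.mk_eq_mk.mp hpq
  have := congrArg (evalEval x y) hr
  rw [evalEval_mul, evalEval_sub, show W.polynomial.evalEval x y = 0 from h, zero_mul] at this
  exact sub_eq_zero.mp this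

lemma finite_X_mem {s : Set K} (hs : s.Finite) :
    {P : W.Point | ∃ x y h, P = .some x y h ∧ x ∈ s}.Finite := by
  classical
  have : {P : W.Point | ∃ x y h, P = .some x y h ∧ x ∈ s} =
      ⋃ a ∈ s, {P : W.Point | ∃ y h, P = .some a y h} := by
    ext P; simp only [Set.mem_ofPred_eq, Set.mem_iUnion]; grind
  rw [this]
  refine hs.biUnion fun a _ => ?_
  by_cases hne : ∃ b, W.Nonsingular a b
  · obtain ⟨b, hb⟩ := hne
    refine (Set.toFinite {Affine.Point.some a b hb, -Affine.Point.some a b hb}).subset ?_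
    rintro P ⟨y, h, rfl⟩
    exact Affine.Point.X_eq_iff.mp rfl
  · convert Set.finite_empty
    ext P
    simp only [Set.mem_ofPred_eq, Set.mem_empty_iff_false, iff_false]
    rintro ⟨y, h, -⟩
    exact hne ⟨y, h⟩

lemma finite_zeros_mk {p : K[X][X]} (hp : Affine.CoordinateRing.mk W p ≠ 0) :
    {P : W.Point | ∃ x y h, P = .some x y h ∧ p.evalEval x y = 0}.Finite := by
  obtain ⟨a, b, hab⟩ := Affine.CoordinateRing.exists_smul_basis_eq (Affine.CoordinateRing.mk W p)
  have hN : Algebra.norm K[X] (Affine.CoordinateRing.mk W p) ≠ 0 := by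
    have : Module.Finite K[X] W.CoordinateRing :=
      Module.Finite.of_basis (Affine.CoordinateRing.basis W)
    exact Algebra.norm_ne_zero_iff.mpr hp
  refine (finite_X_mem (W := W)
    (finite_setOfPred_isRoot hN)).subset ?_
  rintro P ⟨x, y, h, rfl, hP⟩
  refine ⟨x, y, h, rfl, ?_⟩
  have h1 := Affine.CoordinateRing.coe_norm_smul_basis (W' := W) a b
  rw [hab] at h1
  have h2 := evalEval_eq_of_mk_eq h.1 (p := C _) h1
  have h3 := evalEval_eq_of_mk_eq h.1 (p := C a + C b * X) (q := p) (by
    rw [← hab, Affine.CoordinateRing.smul, Affine.CoordinateRing.smul]; simp)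
  rw [evalEval_mul, h3, hP, zero_mul, evalEval_C] at h2
  exact h2

lemma finite_zeros {g : W.FunctionField} (hg : g ≠ 0) :
    {P : W.Point | HasValueAt P g 0}.Finite := by
  obtain ⟨a, b, hb, rfl⟩ := IsFractionRing.div_surjective (A := W.CoordinateRing) g
  have ha : a ≠ 0 := by rintro rfl; simp at hg
  obtain ⟨p, rfl⟩ := AdjoinRoot.mk_surjective a
  obtain ⟨q, rfl⟩ := AdjoinRoot.mk_surjective b
  refine ((Set.finite_singleton (0 : W.Point)).union (finite_zeros_mk ha)).subset ?_
  rintro (_ | ⟨x, y, h⟩) ⟨n, A, B, -, -, hB, hg', hc⟩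
  · exact .inl rfl
  · refine .inr ⟨x, y, h, rfl, ?_⟩
    rw [aeval_xy, aeval_xy] at hg'
    have hA : MvPolynomial.eval ![x, y, 1] A = 0 := by
      rcases div_eq_zero_iff.mp hc.symm with h | h
      exacts [h, (hB h).elim]
    have hB0 : Affine.CoordinateRing.mk W (MvPolynomial.aeval ![C X, X, 1] B) ≠ 0 := by
      intro h0
      apply hB
      have := evalEval_eq_of_mk_eq h.1 (h0.trans (map_zero _).symm)
      rwa [evalEval_aeval, evalEval_zero] at this
    have inj := IsFractionRing.injective W.CoordinateRing W.FunctionField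
    rw [div_eq_div_iff ((map_ne_zero_iff _ inj).mpr (nonZeroDivisors.ne_zero hb))
      ((map_ne_zero_iff _ inj).mpr hB0)] at hg'
    simp only [← map_mul] at hg'
    have := evalEval_eq_of_mk_eq h.1 (inj hg')
    rw [evalEval_mul, evalEval_mul, evalEval_aeval, evalEval_aeval, hA, zero_mul] at this
    exact (mul_eq_zero.mp this).resolve_right hB

lemma exists_hasValueAt_zero (Q : W.Point) : ∃ g : W.FunctionField, g ≠ 0 ∧ HasValueAt Q g 0 := by
  have inj := IsFractionRing.injective W.CoordinateRing W.FunctionField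
  rcases Q with _ | ⟨x, y, h⟩
  · refine ⟨1 / yFun W, one_div_ne_zero ?_, 1, MvPolynomial.X 2, MvPolynomial.X 1,
      MvPolynomial.isHomogeneous_X _ _, MvPolynomial.isHomogeneous_X _ _, ?_, ?_, ?_⟩
    · have := Affine.CoordinateRing.YClass_ne_zero (W' := W) 0
      rw [Affine.CoordinateRing.YClass, C_0, sub_zero] at this
      exact (map_ne_zero_iff _ inj).mpr this
    all_goals simp [projCoords]
  · refine ⟨_, (map_ne_zero_iff _ inj).mpr (Affine.CoordinateRing.XClass_ne_zero (W' := W) x), 1,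
      MvPolynomial.X 0 - MvPolynomial.C x * MvPolynomial.X 2, MvPolynomial.X 2,
      (MvPolynomial.isHomogeneous_X _ _).sub (by
        simpa using (MvPolynomial.isHomogeneous_C _ _).mul (MvPolynomial.isHomogeneous_X _ _)),
      MvPolynomial.isHomogeneous_X _ _, ?_, ?_, ?_⟩
    · simp [projCoords]
    · rw [aeval_xy, aeval_xy]
      simp [Affine.CoordinateRing.XClass]
    · simp [projCoords]

end Finiteness

namespace Isogeny

variable {K : Type*} [Field K] {W₁ W₂ : Affine K} (f : Isogeny W₁ W₂)

lemma finite_fiber (Q : W₂.Point) : {P | f.toFun P = Q}.Finite := by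
  obtain ⟨g, hg, hQ⟩ := exists_hasValueAt_zero Q
  refine (finite_zeros ((map_ne_zero_iff _ f.comap.injective).mpr hg)).subset ?_
  rintro P rfl
  exact f.hasValueAt_comap P g 0 hQ

/-- The kernel of `f`. -/
def ker : Set W₁.Point := {P | f.toFun P = 0}

/-- The degree of `f`: the degree of the extension `K(W₁) / f^* K(W₂)`. -/
def degree : ℕ := Module.finrank f.comap.fieldRange W₁.FunctionField

/-- The ramification index `e_f(P) = ord_P(f^* t)`, where `t` is a uniformizer at `f(P)`. -/
def ramificationIndex (P : W₁.Point) : ℤ :=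
  ord P (f.comap (Classical.epsilon (IsUniformizer (f.toFun P))))

/-- The pullback of divisors: `f^*(Q) = ∑_{f(P) = Q} e_f(P) (P)`, extended linearly. -/
def pullback (D : Divisor W₂) : Divisor W₁ :=
  Finsupp.ofSupportFinite (fun P => f.ramificationIndex P * D (f.toFun P)) (by
    refine (D.support.finite_toSet.biUnion fun Q _ => f.finite_fiber Q).subset fun P hP => ?_
    simp only [Set.mem_iUnion]
    exact ⟨f.toFun P, Finsupp.mem_support_iff.mpr (right_ne_zero_of_mul hP), rfl⟩)

end Isogeny

/-! ### Fields of definition -/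

section Descent

variable {k : Type*} [Field k] (K : Type*) [Field K] [Algebra k K]

/-- The inclusion `k(E) → K(E)` of function fields. -/
def functionFieldMap (E : WeierstrassCurve k) :
    E.toAffine.FunctionField →+* (E.baseChange K).toAffine.FunctionField :=
  IsFractionRing.map (B := (E.baseChange K).toAffine.CoordinateRing)
    (j := Affine.CoordinateRing.map E.toAffine (algebraMap k K))
    (Affine.CoordinateRing.map_injective (W' := E.toAffine) (algebraMap k K).injective)

variable {K}

/-- An isogeny `E → E'` over `K` is defined over `k`: it pulls `k(E')` back into `k(E)`. -/
def Isogeny.DefinedOver {E E' : WeierstrassCurve k}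
    (f : Isogeny (E.baseChange K).toAffine (E'.baseChange K).toAffine) : Prop :=
  ∀ g : E'.toAffine.FunctionField, ∃ g' : E.toAffine.FunctionField,
    f.comap (functionFieldMap K E' g) = functionFieldMap K E g'

/-- Linear equivalence over `k`: the difference is the divisor of a function in `k(E)`. -/
def LinEquivOver {E : WeierstrassCurve k} (D D' : Divisor (E.baseChange K).toAffine) : Prop :=
  ∃ g : E.toAffine.FunctionField, IsDivisorOf (functionFieldMap K E g) (D - D')

end Descent

end

end EllipticIsogeny

/-! An isogeny is a group homomorphism, and in characteristic zero its kernel has `d` points, none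
of them ramified. So the pullback of (O) is the sum of the points of Ker(f), each with multiplicity
one, and Abel's theorem (`exists_isDivisorOf_iff`) turns f^*(O) ~ d(O) into the condition that the
points of Ker(f) add up to O (`Isogeny.linEquiv_pullback_iff`). In a finite abelian group x and -x
cancel unless 2x = 0, and the elements of a group of exponent two add up to zero unless it has order
exactly 2 (`sum_univ_eq_zero_iff`). The 2-torsion of Ker(f) is E[2] ∩ Ker(f).

The geometry is read off from Dedekind domains. The coordinate ring is one; its primes are the
affine points, and the degree of the norm to K[X] is the order of the pole at O. Abel's theorem
follows from the injectivity of `toClass` into the class group and from the fact that principal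
divisors have degree zero (`sum_divisor`).

For an isogeny, the primes of the integral closure of the target's coordinate ring in the function
field of the source are the points outside the kernel. The relative norm of ideals realises f on
points, so f is additive (`Isogeny.map_add`). The different bounds the ramification, so almost every
fibre has exactly `d` points (`Isogeny.card_fiber`), and the kernel is a translate of such a fibre.
Ramification over O, which the integral closure does not see, is controlled by (Q) + (-Q) ~ 2(O).

Over k, let g have divisor f^*(O) - d(O). Away from O, the divisors of g² and g³ are the polar parts
of f^*x and f^*y, which lie in k(E). A k-linear functional K → k applied to the coefficients of g²
and g³ gives functions over k with the same divisors (`exists_functionFieldMap_ord_eq`), and their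
quotient has the divisor of g. -/

namespace EllipticIsogeny

open WeierstrassCurve Polynomial IsDedekindDomain nonZeroDivisors

noncomputable section

/-! ### Maximal ideals of the coordinate ring, and its Dedekind property -/

section MaximalIdeals

variable {K : Type*} [Field K] {W : Affine K}

lemma isMaximal_XYIdeal {x y : K} (h : W.Equation x y) :
    (Affine.CoordinateRing.XYIdeal W x (C y)).IsMaximal :=
  Ideal.Quotient.maximal_of_isField _
    ((Affine.CoordinateRing.quotientXYIdealEquiv h).toMulEquiv.isField (Field.toIsField K))

/-- The ideal lies in the kernel of evaluation at the point; being maximal, it is the whole kernel.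
-/
lemma mk_mem_XYIdeal_iff {x y : K} (h : W.Equation x y) (p : K[X][X]) :
    Affine.CoordinateRing.mk W p ∈ Affine.CoordinateRing.XYIdeal W x (C y) ↔
      p.evalEval x y = 0 := by
  let φ : W.CoordinateRing →+* K := AdjoinRoot.evalEval h
  have hφ (q : K[X][X]) : φ (Affine.CoordinateRing.mk W q) = q.evalEval x y :=
    AdjoinRoot.evalEval_mk h q
  have hle : Affine.CoordinateRing.XYIdeal W x (C y) ≤ RingHom.ker φ := by
    rw [Affine.CoordinateRing.XYIdeal, Ideal.span_le]
    rintro _ (rfl | rfl)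
    · change φ (Affine.CoordinateRing.mk W _) = 0
      rw [hφ]; simp [evalEval]
    · change φ (Affine.CoordinateRing.mk W _) = 0
      rw [hφ]; simp [evalEval]
  rw [(isMaximal_XYIdeal h).eq_of_le (RingHom.ker_ne_top φ) hle, RingHom.mem_ker, hφ]

lemma XYIdeal_injective {x y x' y' : K} (h : W.Equation x y) (h' : W.Equation x' y')
    (he : Affine.CoordinateRing.XYIdeal W x (C y) = Affine.CoordinateRing.XYIdeal W x' (C y')) :
    x = x' ∧ y = y' := by
  have h1 := (mk_mem_XYIdeal_iff h (C (X - C x'))).mp (he ▸ (mk_mem_XYIdeal_iff h' _).mpr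
    (by simp [evalEval]))
  have h2 := (mk_mem_XYIdeal_iff h (X - C (C y'))).mp (he ▸ (mk_mem_XYIdeal_iff h' _).mpr
    (by simp [evalEval]))
  simp only [evalEval, eval_C, eval_sub, eval_X] at h1 h2
  exact ⟨sub_eq_zero.mp h1, sub_eq_zero.mp h2⟩

instance : Algebra.FiniteType K W.CoordinateRing :=
  have : Module.Finite K[X] W.CoordinateRing :=
    Module.Finite.of_basis (Affine.CoordinateRing.basis W)
  Algebra.FiniteType.trans (S := K[X]) inferInstance inferInstance

instance : IsNoetherianRing W.CoordinateRing := Algebra.FiniteType.isNoetherianRing K _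

/-- Nullstellensatz: the residue field is of finite type over K, hence finite, hence K itself. The
coordinates of the point are the residues of x and y. -/
lemma exists_eq_XYIdeal [IsAlgClosed K] (I : Ideal W.CoordinateRing) [hI : I.IsMaximal] :
    ∃ x y, W.Equation x y ∧ I = Affine.CoordinateRing.XYIdeal W x (C y) := by
  let := Ideal.Quotient.field I
  have : Algebra.FiniteType K (W.CoordinateRing ⧸ I) :=
    Algebra.FiniteType.trans (S := W.CoordinateRing) inferInstance inferInstance
  have := finite_of_finite_type_of_isJacobsonRing K (W.CoordinateRing ⧸ I)
  have hs : Function.Surjective (algebraMap K (W.CoordinateRing ⧸ I)) :=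
    IsAlgClosed.algebraMap_bijective_of_isIntegral.surjective
  obtain ⟨x, hx⟩ := hs (Ideal.Quotient.mk I (Affine.CoordinateRing.mk W (C X)))
  obtain ⟨y, hy⟩ := hs (Ideal.Quotient.mk I (Affine.CoordinateRing.mk W X))
  have key (p : K[X][X]) : Ideal.Quotient.mk I (Affine.CoordinateRing.mk W p) =
      algebraMap K (W.CoordinateRing ⧸ I) (p.evalEval x y) := by
    have : ((Ideal.Quotient.mk I).comp (Affine.CoordinateRing.mk W)) =
        (algebraMap K (W.CoordinateRing ⧸ I)).comp (evalEvalRingHom x y) := by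
      refine Polynomial.ringHom_ext' (Polynomial.ringHom_ext' ?_ ?_) ?_
      · ext a
        simp only [RingHom.comp_apply, coe_evalRingHom, eval_C]
        rfl
      · simp only [RingHom.comp_apply]
        rw [← hx]; simp
      · simp only [RingHom.comp_apply]
        rw [← hy]; simp
    exact congrArg (fun f => f p) this
  have heq : W.Equation x y := by
    have := key W.polynomial
    rw [AdjoinRoot.mk_self, map_zero] at this
    exact ((map_eq_zero _).mp this.symm)
  refine ⟨x, y, heq, ((isMaximal_XYIdeal heq).eq_of_le hI.ne_top ?_).symm⟩
  intro a ha
  obtain ⟨p, rfl⟩ := AdjoinRoot.mk_surjective a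
  rw [← Ideal.Quotient.eq_zero_iff_mem]
  exact (key p).trans (by rw [(mk_mem_XYIdeal_iff heq p).mp ha, map_zero])

end MaximalIdeals

/-- A Noetherian domain whose maximal ideals are invertible is a Dedekind domain. -/
lemma isDedekindDomain_of_isUnit_maximal {A : Type*} (F : Type*) [CommRing A] [IsDomain A]
    [IsNoetherianRing A] [Field F] [Algebra A F] [IsFractionRing A F]
    (h : ∀ M : Ideal A, M.IsMaximal → IsUnit (M : FractionalIdeal A⁰ F)) :
    IsDedekindDomain A := by
  -- Noetherian induction from above: if I lies in a maximal ideal M, then J = I M⁻¹ is an integral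
  -- ideal strictly larger than I, and I = J M.
  have key (I : Ideal A) (hI : I ≠ ⊥) : IsUnit (I : FractionalIdeal A⁰ F) := by
    induction I using IsNoetherian.induction with
    | hgt I ih =>
    by_cases hT : I = ⊤
    · simp [hT]
    obtain ⟨M, hM, hIM⟩ := Ideal.exists_le_maximal I hT
    obtain ⟨u, hu⟩ := h M hM
    have hle : (I : FractionalIdeal A⁰ F) * ↑u⁻¹ ≤ 1 := by
      calc (I : FractionalIdeal A⁰ F) * ↑u⁻¹ ≤ u * ↑u⁻¹ := by
            rw [hu]; gcongr
        _ = 1 := u.mul_inv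
    obtain ⟨J, hJ⟩ := FractionalIdeal.le_one_iff_exists_coeIdeal.mp hle
    have hIJ : I = J * M := by
      rw [← FractionalIdeal.coeIdeal_inj (K := F), FractionalIdeal.coeIdeal_mul, hJ, ← hu,
        mul_assoc, u.inv_mul, mul_one]
    -- If I = J then I = I M. Nakayama gives r ≡ 1 mod M that kills I; in a domain r = 0, so 1 lies
    -- in M.
    have hne : I ≠ J := by
      rintro rfl
      obtain ⟨r, hr, hr'⟩ := Submodule.exists_sub_one_mem_and_smul_eq_zero_of_fg_of_le_smul M I
        ((isNoetherianRing_iff_ideal_fg A).mp inferInstance I)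
        (by rw [smul_eq_mul, mul_comm, ← hIJ])
      obtain ⟨a, ha, ha0⟩ := Submodule.exists_mem_ne_zero_of_ne_bot hI
      have : r = 0 := (mul_eq_zero.mp (hr' a ha)).resolve_right ha0
      rw [this, zero_sub, neg_mem_iff] at hr
      exact hM.ne_top ((Ideal.eq_top_iff_one _).mpr hr)
    have hlt : I < J := lt_of_le_of_ne (hIJ ▸ Ideal.mul_le_left) hne
    rw [hIJ, FractionalIdeal.coeIdeal_mul, ← hu]
    exact (ih J hlt (by rintro rfl; simp at hlt)).mul u.isUnit
  rw [isDedekindDomain_iff_mul_inv_cancel (K := F)]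
  intro I hI
  obtain ⟨a, J, ha, rfl⟩ := FractionalIdeal.exists_eq_spanSingleton_mul I
  rw [FractionalIdeal.mul_inv_cancel_iff_isUnit]
  have hF : algebraMap A F a ≠ 0 := by
    simpa using ha
  refine IsUnit.mul ?_ (key J ?_)
  · refine IsUnit.of_mul_eq_one (FractionalIdeal.spanSingleton A⁰ (algebraMap A F a)) ?_
    rw [FractionalIdeal.spanSingleton_mul_spanSingleton, inv_mul_cancel₀ hF,
      FractionalIdeal.spanSingleton_one]
  · rintro rfl
    exact hI (by simp)

section Dedekind

variable {K : Type*} [Field K] {W : Affine K}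

/-- Every solution of the equation of an elliptic curve is a nonsingular point, and ideals of
nonsingular points are invertible. -/
instance [IsAlgClosed K] [W.IsElliptic] : IsDedekindDomain W.CoordinateRing := by
  refine isDedekindDomain_of_isUnit_maximal W.FunctionField fun M hM => ?_
  obtain ⟨x, y, h, rfl⟩ := exists_eq_XYIdeal M
  exact (Affine.CoordinateRing.XYIdeal' (W.equation_iff_nonsingular.mp h)).isUnit

/-- The maximal ideal of the coordinate ring at an affine point. -/
def place {x y : K} (h : W.Nonsingular x y) : HeightOneSpectrum W.CoordinateRing where
  asIdeal := Affine.CoordinateRing.XYIdeal W x (C y)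
  isPrime := (isMaximal_XYIdeal h.1).isPrime
  ne_bot := fun hb => Affine.CoordinateRing.XClass_ne_zero (W' := W) x <| by
    have : Affine.CoordinateRing.XClass W x ∈ Affine.CoordinateRing.XYIdeal W x (C y) :=
      Ideal.subset_span (by simp)
    rwa [hb] at this

lemma exists_eq_place [IsAlgClosed K] [W.IsElliptic] (v : HeightOneSpectrum W.CoordinateRing) :
    ∃ x y, ∃ h : W.Nonsingular x y, v = place h := by
  have := v.isMaximal
  obtain ⟨x, y, h, hv⟩ := exists_eq_XYIdeal v.asIdeal
  exact ⟨x, y, W.equation_iff_nonsingular.mp h, HeightOneSpectrum.ext hv⟩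

end Dedekind

end

end EllipticIsogeny

namespace EllipticIsogeny

open WeierstrassCurve Polynomial IsDedekindDomain nonZeroDivisors

noncomputable section

/-! ### Pole order at infinity, and forms in the coordinates -/

section PoleOrder

variable {K : Type*} [Field K] {W : Affine K}

lemma repr_smul_basis (a : W.CoordinateRing) :
    (Affine.CoordinateRing.basis W).repr a 0 • (1 : W.CoordinateRing) +
      (Affine.CoordinateRing.basis W).repr a 1 • Affine.CoordinateRing.mk W X = a := by
  conv_rhs => rw [← (Affine.CoordinateRing.basis W).sum_repr a]
  rw [Fin.sum_univ_two, Affine.CoordinateRing.basis_zero, Affine.CoordinateRing.basis_one]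

/-- The norm of p + q y has degree max(2 deg p, 2 deg q + 3), which is the order of the pole at O: x
counts 2 and y counts 3, and the two parts cannot cancel because their parities differ. -/
lemma degree_norm_lt_iff (a : W.CoordinateRing) (m : ℕ) :
    (Algebra.norm K[X] a).degree < m ↔
      (∀ i, m ≤ 2 * i → ((Affine.CoordinateRing.basis W).repr a 0).coeff i = 0) ∧
      (∀ i, m ≤ 2 * i + 3 → ((Affine.CoordinateRing.basis W).repr a 1).coeff i = 0) := by
  conv_lhs => rw [← repr_smul_basis a]
  rw [Affine.CoordinateRing.degree_norm_smul_basis, max_lt_iff]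
  have h (p : K[X]) (c : ℕ) : 2 • p.degree + c < m ↔ ∀ i, m ≤ 2 * i + c → p.coeff i = 0 := by
    by_cases hp : p = 0
    · simp [hp]
    · rw [degree_eq_natDegree hp]
      constructor
      · intro h i hi
        refine coeff_eq_zero_of_natDegree_lt ?_
        rw [nsmul_eq_mul] at h
        norm_cast at h
        lia
      · intro h
        by_contra! hc
        refine hp (leadingCoeff_eq_zero.mp (h _ ?_))
        rw [nsmul_eq_mul] at hc
        exact_mod_cast hc
  have h0 := h ((Affine.CoordinateRing.basis W).repr a 0) 0
  simp only [Nat.cast_zero, add_zero] at h0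
  exact and_congr h0 (h _ 3)

variable (W) in
/-- The functional that reads off the coefficient of the pole of order `m` at infinity. -/
def topCoeff (m : ℕ) (a : W.CoordinateRing) : K :=
  if Even m then ((Affine.CoordinateRing.basis W).repr a 0).coeff (m / 2)
  else if m = 1 then 0 else ((Affine.CoordinateRing.basis W).repr a 1).coeff ((m - 3) / 2)

lemma repr_C_smul (c : K) (a : W.CoordinateRing) (i : Fin 2) :
    (Affine.CoordinateRing.basis W).repr (c • a) i =
      c • (Affine.CoordinateRing.basis W).repr a i := by
  rw [← algebraMap_smul K[X] c a, map_smul, Finsupp.smul_apply, algebraMap_smul]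

lemma topCoeff_sub (m : ℕ) (a b : W.CoordinateRing) :
    topCoeff W m (a - b) = topCoeff W m a - topCoeff W m b := by
  unfold topCoeff
  split_ifs <;> simp

lemma topCoeff_smul (m : ℕ) (c : K) (a : W.CoordinateRing) :
    topCoeff W m (c • a) = c * topCoeff W m a := by
  unfold topCoeff
  split_ifs <;> simp [repr_C_smul]

/-- Each pole order m is reached by a single basis monomial, except that none reaches m = 1; there
the functional is set to zero and the two bounds on the degree coincide. -/
lemma degree_norm_lt_iff_topCoeff (a : W.CoordinateRing) (m : ℕ) :
    (Algebra.norm K[X] a).degree < m ↔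
      (Algebra.norm K[X] a).degree < (m + 1 : ℕ) ∧ topCoeff W m a = 0 := by
  rw [degree_norm_lt_iff, degree_norm_lt_iff, topCoeff]
  constructor
  · rintro ⟨h1, h2⟩
    refine ⟨⟨fun i hi => h1 i (by lia), fun i hi => h2 i (by lia)⟩, ?_⟩
    split_ifs with he ho
    · exact h1 _ (by grind)
    · rfl
    · exact h2 _ (by grind)
  · rintro ⟨⟨h1, h2⟩, h3⟩
    split_ifs at h3 with he ho
    · refine ⟨fun i hi => ?_, fun i hi => h2 i (by grind)⟩
      rcases hi.eq_or_lt with rfl | hlt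
      · rwa [Nat.mul_div_cancel_left _ two_pos] at h3
      · exact h1 i hlt
    · exact ⟨fun i hi => h1 i (by grind), fun i hi => h2 i (by grind)⟩
    · refine ⟨fun i hi => h1 i (by grind), fun i hi => ?_⟩
      rcases hi.eq_or_lt with rfl | hlt
      · rwa [Nat.add_sub_cancel, Nat.mul_div_cancel_left _ two_pos] at h3
      · exact h2 i hlt

lemma degree_norm_add_lt {a b : W.CoordinateRing} {m : ℕ} (ha : (Algebra.norm K[X] a).degree < m)
    (hb : (Algebra.norm K[X] b).degree < m) : (Algebra.norm K[X] (a + b)).degree < m := by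
  rw [degree_norm_lt_iff] at *
  simp only [map_add, Finsupp.add_apply, coeff_add]
  exact ⟨fun i hi => by rw [ha.1 i hi, hb.1 i hi, add_zero],
    fun i hi => by rw [ha.2 i hi, hb.2 i hi, add_zero]⟩

lemma degree_norm_smul_lt {a : W.CoordinateRing} {m : ℕ} (ha : (Algebra.norm K[X] a).degree < m)
    (c : K) : (Algebra.norm K[X] (c • a)).degree < m := by
  rw [degree_norm_lt_iff] at *
  simp only [repr_C_smul, coeff_smul]
  exact ⟨fun i hi => by rw [ha.1 i hi, smul_zero], fun i hi => by rw [ha.2 i hi, smul_zero]⟩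

lemma norm_ne_zero {a : W.CoordinateRing} (ha : a ≠ 0) : Algebra.norm K[X] a ≠ 0 :=
  have : Module.Finite K[X] W.CoordinateRing :=
    Module.Finite.of_basis (Affine.CoordinateRing.basis W)
  Algebra.norm_ne_zero_iff.mpr ha

lemma degree_norm_x_pow_mul_y_pow (i j : ℕ) : (Algebra.norm K[X]
    (Affine.CoordinateRing.mk W (C X ^ i * X ^ j))).degree = (2 * i + 3 * j : ℕ) := by
  have hx : (Algebra.norm K[X] (Affine.CoordinateRing.mk W (C X))).degree = (2 : ℕ) := by
    have := Affine.CoordinateRing.degree_norm_smul_basis (W' := W) X 0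
    rw [Affine.CoordinateRing.smul, zero_smul, mul_one, add_zero] at this
    rw [this]; simp
  have hy : (Algebra.norm K[X] (Affine.CoordinateRing.mk W X)).degree = (3 : ℕ) := by
    have := Affine.CoordinateRing.degree_norm_smul_basis (W' := W) 0 1
    rw [zero_smul, zero_add, one_smul] at this
    rw [this]; simp
  rw [map_mul, map_pow, map_pow, map_mul, map_pow, map_pow, degree_mul, degree_pow, degree_pow,
    hx, hy]
  push_cast
  simp [mul_comm]

end PoleOrder

section Forms

variable {K : Type*} [Field K] (W : Affine K)

/-- The elements `A(x, y, 1)` of the coordinate ring, for `A` a form of degree `n`. -/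
def IsForm (n : ℕ) (a : W.CoordinateRing) : Prop :=
  ∃ A : MvPolynomial (Fin 3) K, A.IsHomogeneous n ∧
    Affine.CoordinateRing.mk W (MvPolynomial.aeval ![C X, X, 1] A) = a

variable {W}

lemma IsForm.add {n : ℕ} {a b : W.CoordinateRing} (ha : IsForm W n a) (hb : IsForm W n b) :
    IsForm W n (a + b) := by
  obtain ⟨A, hA, rfl⟩ := ha
  obtain ⟨B, hB, rfl⟩ := hb
  exact ⟨A + B, hA.add hB, by rw [map_add, map_add]⟩

lemma IsForm.mul {m n : ℕ} {a b : W.CoordinateRing} (ha : IsForm W m a) (hb : IsForm W n b) :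
    IsForm W (m + n) (a * b) := by
  obtain ⟨A, hA, rfl⟩ := ha
  obtain ⟨B, hB, rfl⟩ := hb
  exact ⟨A * B, hA.mul hB, by rw [map_mul, map_mul]⟩

lemma isForm_algebraMap (c : K) : IsForm W 0 (algebraMap K W.CoordinateRing c) :=
  ⟨MvPolynomial.C c, MvPolynomial.isHomogeneous_C _ _, by rw [MvPolynomial.aeval_C]; rfl⟩

lemma IsForm.smul {n : ℕ} {a : W.CoordinateRing} (ha : IsForm W n a) (c : K) :
    IsForm W n (c • a) := by
  rw [Algebra.smul_def, ← zero_add n]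
  exact (isForm_algebraMap c).mul ha

lemma isForm_x_pow_mul_y_pow {i j n : ℕ} (h : i + j ≤ n) :
    IsForm W n (Affine.CoordinateRing.mk W (C X ^ i * X ^ j)) := by
  refine ⟨MvPolynomial.X 0 ^ i * MvPolynomial.X 1 ^ j * MvPolynomial.X 2 ^ (n - (i + j)), ?_, ?_⟩
  · have := (((MvPolynomial.isHomogeneous_X_pow (R := K) (0 : Fin 3) i).mul
      (MvPolynomial.isHomogeneous_X_pow 1 j)).mul
      (MvPolynomial.isHomogeneous_X_pow 2 (n - (i + j))))
    rwa [Nat.add_sub_cancel' h] at this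
  · simp

lemma IsForm.mono {m n : ℕ} (h : m ≤ n) {a : W.CoordinateRing} (ha : IsForm W m a) :
    IsForm W n a := by
  obtain ⟨k, rfl⟩ := Nat.exists_eq_add_of_le h
  simpa using ha.mul (isForm_x_pow_mul_y_pow (W := W) (i := 0) (j := 0) (n := k) (by simp))

lemma exists_isForm (a : W.CoordinateRing) : ∃ n, IsForm W n a := by
  obtain ⟨p, rfl⟩ := AdjoinRoot.mk_surjective a
  induction p using Polynomial.induction_on' with
  | add p q hp hq =>
    obtain ⟨m, hm⟩ := hp
    obtain ⟨n, hn⟩ := hq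
    rw [map_add]
    exact ⟨max m n, (hm.mono (le_max_left _ _)).add (hn.mono (le_max_right _ _))⟩
  | monomial j p =>
    induction p using Polynomial.induction_on' with
    | add p q hp hq =>
      obtain ⟨m, hm⟩ := hp
      obtain ⟨n, hn⟩ := hq
      rw [map_add, map_add]
      exact ⟨max m n, (hm.mono (le_max_left _ _)).add (hn.mono (le_max_right _ _))⟩
    | monomial i c =>
      refine ⟨0 + (i + j), ?_⟩
      rw [← C_mul_X_pow_eq_monomial, ← C_mul_X_pow_eq_monomial, C_mul, C_pow, mul_assoc, map_mul]
      exact (isForm_algebraMap c).mul (isForm_x_pow_mul_y_pow le_rfl)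

/-- Functions with a pole of order at most `3n` at infinity and no other poles are given by forms
of degree `n`. -/
lemma isForm_of_degree_norm_lt {a : W.CoordinateRing} {n : ℕ}
    (ha : (Algebra.norm K[X] a).degree < (3 * n + 1 : ℕ)) : IsForm W n a := by
  suffices ∀ m ≤ 3 * n + 1, ∀ a : W.CoordinateRing, (Algebra.norm K[X] a).degree < m →
      IsForm W n a from this _ le_rfl a ha
  clear ha a
  intro m
  induction m with
  | zero =>
    intro _ a ha
    have : a = 0 := by
      by_contra h0
      rw [Nat.cast_zero] at ha
      exact norm_ne_zero h0 (degree_eq_bot.mp (Nat.WithBot.lt_zero_iff.mp ha))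
    rw [this]
    exact ⟨0, MvPolynomial.isHomogeneous_zero _ _ _, by simp⟩
  | succ m ih =>
    intro hm a ha
    by_cases h1 : m = 1
    · exact ih (by lia) a ((degree_norm_lt_iff_topCoeff a m).mpr ⟨ha, by simp [topCoeff, h1]⟩)
    -- Among the monomials with pole of order m, take the one with most factors y, so that its
    -- degree i + j is least. The residue 1 needs x², hence m ≥ 4; this is where m = 1 had to be set
    -- aside.
    obtain ⟨i, j, hij, hn⟩ : ∃ i j, 2 * i + 3 * j = m ∧ i + j ≤ n := by
      have : m % 3 = 0 ∨ m % 3 = 1 ∨ m % 3 = 2 := by lia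
      rcases this with h | h | h
      · exact ⟨0, m / 3, by lia, by lia⟩
      · exact ⟨2, (m - 4) / 3, by lia, by lia⟩
      · exact ⟨1, (m - 2) / 3, by lia, by lia⟩
    set e := Affine.CoordinateRing.mk W (C X ^ i * X ^ j) with he
    have hd : (Algebra.norm K[X] e).degree = m := by rw [he, degree_norm_x_pow_mul_y_pow, hij]
    have htop : topCoeff W m e ≠ 0 := fun h0 => by
      have := (degree_norm_lt_iff_topCoeff e m).mpr ⟨by rw [hd]; exact_mod_cast m.lt_succ_self, h0⟩
      exact (hd ▸ this).false
    have hs : (Algebra.norm K[X] (a - (topCoeff W m a / topCoeff W m e) • e)).degree < m := by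
      refine (degree_norm_lt_iff_topCoeff _ m).mpr ⟨?_, ?_⟩
      · rw [sub_eq_add_neg, ← neg_smul]
        exact degree_norm_add_lt ha (degree_norm_smul_lt
          (by rw [hd]; exact_mod_cast m.lt_succ_self) _)
      · rw [topCoeff_sub, topCoeff_smul, div_mul_cancel₀ _ htop, sub_self]
    have := (ih (by lia) _ hs).add ((isForm_x_pow_mul_y_pow (W := W) hn).smul
      (topCoeff W m a / topCoeff W m e))
    rwa [← he, sub_add_cancel] at this

/-- The value at [0 : 1 : 0] is the coefficient of Y^n. Any other monomial X^a Y^b Z^c of degree n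
has b < n, so its pole order 2a + 3b is below 3n. -/
lemma degree_norm_form_lt_of_eval_eq_zero {A : MvPolynomial (Fin 3) K} {n : ℕ}
    (hA : A.IsHomogeneous n) (h0 : MvPolynomial.eval ![0, 1, 0] A = 0) :
    (Algebra.norm K[X] (Affine.CoordinateRing.mk W
      (MvPolynomial.aeval ![C X, X, 1] A))).degree < (3 * n : ℕ) := by
  have hsum (d) (hd : d ∈ A.support) : d 0 + d 1 + d 2 = n := by
    have := hA (MvPolynomial.mem_support_iff.mp hd)
    rw [Finsupp.weight_apply, Finsupp.sum_fintype _ _ (by simp), Fin.sum_univ_three] at this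
    simpa using this
  have hc (d) (hd : d ∈ A.support) : d 1 < n := by
    refine lt_of_le_of_ne (by have := hsum d hd; lia) fun h1 => ?_
    have hd' : d 0 = 0 ∧ d 2 = 0 := by have := hsum d hd; lia
    refine MvPolynomial.mem_support_iff.mp hd ?_
    rw [MvPolynomial.eval_eq', Finset.sum_eq_single_of_mem d hd] at h0
    · simpa [Fin.prod_univ_three, hd'] using h0
    · intro b hb hbd
      rw [Fin.prod_univ_three]
      by_cases hb0 : b 0 = 0
      · by_cases hb2 : b 2 = 0
        · refine absurd ?_ hbd
          have := hsum b hb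
          ext i
          fin_cases i
          · simp [hb0, hd']
          · simp only [Fin.mk_one]; lia
          · simp [hb2, hd']
        · simp [hb2]
      · simp [hb0]
  rw [MvPolynomial.aeval_def, MvPolynomial.eval₂_eq', map_sum]
  refine Finset.sum_induction _
    (fun a : W.CoordinateRing => (Algebra.norm K[X] a).degree < (3 * n : ℕ))
    (fun _ _ => degree_norm_add_lt) ?_ fun d hd => ?_
  · have : Module.Finite K[X] W.CoordinateRing :=
      Module.Finite.of_basis (Affine.CoordinateRing.basis W)
    rw [Algebra.norm_zero, degree_zero]
    exact WithBot.bot_lt_coe _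
  · have : Affine.CoordinateRing.mk W (algebraMap K K[X][X] (A.coeff d) *
        ∏ i, (![C X, X, 1] : Fin 3 → K[X][X]) i ^ d i) =
        A.coeff d • Affine.CoordinateRing.mk W (C X ^ d 0 * X ^ d 1) := by
      rw [map_mul, Algebra.smul_def, Fin.prod_univ_three]
      simp only [Matrix.cons_val, one_pow, mul_one]
      rfl
    rw [this]
    refine degree_norm_smul_lt ?_ _
    rw [degree_norm_x_pow_mul_y_pow]
    have h1 := hc d hd
    have h2 := hsum d hd
    exact_mod_cast (by lia)

/-- Subtracting c Y^n reduces to the preceding case, and c y^n has a pole of order exactly 3n. -/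
lemma degree_norm_form_of_eval_ne_zero {A : MvPolynomial (Fin 3) K} {n : ℕ}
    (hA : A.IsHomogeneous n) (h0 : MvPolynomial.eval ![0, 1, 0] A ≠ 0) :
    (Algebra.norm K[X] (Affine.CoordinateRing.mk W
      (MvPolynomial.aeval ![C X, X, 1] A))).degree = (3 * n : ℕ) := by
  set c := MvPolynomial.eval ![0, 1, 0] A with hc
  have hB : (A - MvPolynomial.C c * MvPolynomial.X 1 ^ n).IsHomogeneous n := by
    refine hA.sub ?_
    simpa using (MvPolynomial.isHomogeneous_C (Fin 3) c).mul
      (MvPolynomial.isHomogeneous_X_pow 1 n)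
  have h1 := degree_norm_form_lt_of_eval_eq_zero (W := W) hB (by simp [hc])
  set a := Affine.CoordinateRing.mk W (MvPolynomial.aeval ![C X, X, 1] A) with ha
  set e := Affine.CoordinateRing.mk W (C X ^ 0 * X ^ n) with he
  have hb : Affine.CoordinateRing.mk W (MvPolynomial.aeval ![C X, X, 1]
      (A - MvPolynomial.C c * MvPolynomial.X 1 ^ n)) = a - c • e := by
    rw [map_sub, map_sub, ha, Algebra.smul_def, he, map_mul, map_mul, map_pow,
      MvPolynomial.aeval_C, MvPolynomial.aeval_X, pow_zero, one_mul]
    rfl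
  have hd : (Algebra.norm K[X] e).degree = (3 * n : ℕ) := by
    rw [he, degree_norm_x_pow_mul_y_pow]; simp
  rw [hb] at h1
  refine le_antisymm ?_ ?_
  · have h2 : (Algebra.norm K[X] (c • e)).degree < (3 * n + 1 : ℕ) :=
      degree_norm_smul_lt (by rw [hd]; exact_mod_cast Nat.lt_succ_self _) c
    have h3 := degree_norm_add_lt (h1.trans (by exact_mod_cast Nat.lt_succ_self _)) h2
    rw [sub_add_cancel] at h3
    exact (degree_le_iff_coeff_zero _ _).mpr fun m hm =>
      (degree_lt_iff_coeff_zero _ _).mp h3 m (by exact_mod_cast hm)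
  · by_contra! hlt
    have h4 := degree_norm_smul_lt (degree_norm_add_lt hlt
      (degree_norm_smul_lt h1 (-1))) c⁻¹
    have : c⁻¹ • (a + (-1 : K) • (a - c • e)) = e := by
      rw [neg_one_smul, neg_sub, add_sub_cancel, smul_smul, inv_mul_cancel₀ h0, one_smul]
    rw [this, hd] at h4
    exact h4.false

end Forms

end

end EllipticIsogeny

namespace EllipticIsogeny

open WeierstrassCurve Polynomial IsDedekindDomain nonZeroDivisors WithZero

noncomputable section

/-! ### The valuation at a point, compared with values, regularity and order -/

section Valuations

variable {K : Type*} [Field K] (W : Affine K)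

open Classical in
/-- The valuation at infinity on the coordinate ring. -/
def inftyIntValuation : Valuation W.CoordinateRing ℤᵐ⁰ where
  toFun a := if a = 0 then 0 else exp ((Algebra.norm K[X] a).natDegree : ℤ)
  map_zero' := by simp
  map_one' := by simp
  map_mul' a b := by
    by_cases ha : a = 0
    · simp [ha]
    by_cases hb : b = 0
    · simp [hb]
    rw [if_neg ha, if_neg hb, if_neg (mul_ne_zero ha hb), map_mul,
      natDegree_mul (norm_ne_zero ha) (norm_ne_zero hb), Nat.cast_add, exp_add]
  map_add_le_max' a b := by
    by_cases ha : a = 0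
    · simp [ha]
    by_cases hb : b = 0
    · simp [hb]
    by_cases hab : a + b = 0
    · simp [hab]
    rw [if_neg ha, if_neg hb, if_neg hab, le_max_iff, exp_le_exp, exp_le_exp, Nat.cast_le,
      Nat.cast_le, ← le_max_iff]
    set m := max (Algebra.norm K[X] a).natDegree (Algebra.norm K[X] b).natDegree
    have h1 : (Algebra.norm K[X] a).degree < (m + 1 : ℕ) :=
      (natDegree_lt_iff_degree_lt (norm_ne_zero ha)).mp (Nat.lt_succ_of_le (le_max_left _ _))
    have h2 : (Algebra.norm K[X] b).degree < (m + 1 : ℕ) :=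
      (natDegree_lt_iff_degree_lt (norm_ne_zero hb)).mp (Nat.lt_succ_of_le (le_max_right _ _))
    exact Nat.le_of_lt_succ
      ((natDegree_lt_iff_degree_lt (norm_ne_zero hab)).mpr (degree_norm_add_lt h1 h2))

variable {W}

lemma inftyIntValuation_apply {a : W.CoordinateRing} (ha : a ≠ 0) :
    inftyIntValuation W a = exp ((Algebra.norm K[X] a).natDegree : ℤ) := if_neg ha

lemma inftyIntValuation_lt_exp_iff (a : W.CoordinateRing) (m : ℕ) :
    inftyIntValuation W a < exp (m : ℤ) ↔ (Algebra.norm K[X] a).degree < m := by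
  by_cases ha : a = 0
  · have : Module.Finite K[X] W.CoordinateRing :=
      Module.Finite.of_basis (Affine.CoordinateRing.basis W)
    simp [ha, Algebra.norm_zero]
  · rw [inftyIntValuation_apply ha, exp_lt_exp, Nat.cast_lt,
      natDegree_lt_iff_degree_lt (norm_ne_zero ha)]

variable (W) in
/-- The valuation at infinity on the function field. -/
def inftyValuation : Valuation W.FunctionField ℤᵐ⁰ :=
  (inftyIntValuation W).extendToLocalization (S := W.CoordinateRing⁰) (fun a ha => by
    change inftyIntValuation W a ≠ 0
    rw [inftyIntValuation_apply (nonZeroDivisors.ne_zero ha)]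
    exact exp_ne_zero) W.FunctionField

lemma inftyValuation_algebraMap (a : W.CoordinateRing) :
    inftyValuation W (algebraMap W.CoordinateRing W.FunctionField a) = inftyIntValuation W a :=
  Valuation.extendToLocalization_apply_map_apply ..

/-- The valuation of the forms of degree `n` that do not vanish at a point. -/
def formVal (n : ℕ) : W.Point → ℤᵐ⁰
  | .zero => exp ((3 * n : ℕ) : ℤ)
  | .some _ _ _ => 1

lemma formVal_ne_zero (n : ℕ) (P : W.Point) : formVal n P ≠ 0 := by
  cases P with
  | zero => exact exp_ne_zero
  | some x y h => exact one_ne_zero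

variable [IsAlgClosed K] [W.IsElliptic]

/-- The valuation at a point. -/
def val : W.Point → Valuation W.FunctionField ℤᵐ⁰
  | .zero => inftyValuation W
  | .some _ _ h => (place h).valuation W.FunctionField

lemma val_zero : val (0 : W.Point) = inftyValuation W := rfl

lemma val_some {x y : K} (h : W.Nonsingular x y) :
    val (.some x y h) = (place h).valuation W.FunctionField := rfl

/-- With `val_form_eq`, this translates the quotients A / B of `HasValueAt` into valuations:
`formVal n P` is common to numerator and denominator and cancels. -/
lemma val_form_lt {P : W.Point} {A : MvPolynomial (Fin 3) K} {n : ℕ} (hA : A.IsHomogeneous n)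
    (h0 : MvPolynomial.eval (projCoords P) A = 0) :
    val P (MvPolynomial.aeval ![xFun W, yFun W, 1] A) < formVal n P := by
  rw [aeval_xy]
  cases P with
  | zero =>
    change inftyValuation W _ < exp ((3 * n : ℕ) : ℤ)
    rw [inftyValuation_algebraMap, inftyIntValuation_lt_exp_iff]
    exact degree_norm_form_lt_of_eval_eq_zero hA h0
  | some x y h =>
    change (place h).valuation W.FunctionField _ < 1
    refine ((place h).valuation_lt_one_iff_mem _).mpr ((mk_mem_XYIdeal_iff h.1 _).mpr ?_)
    rw [evalEval_aeval]; exact h0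

lemma val_form_eq {P : W.Point} {A : MvPolynomial (Fin 3) K} {n : ℕ} (hA : A.IsHomogeneous n)
    (h0 : MvPolynomial.eval (projCoords P) A ≠ 0) :
    val P (MvPolynomial.aeval ![xFun W, yFun W, 1] A) = formVal n P := by
  rw [aeval_xy]
  cases P with
  | zero =>
    change inftyValuation W _ = exp ((3 * n : ℕ) : ℤ)
    have := degree_norm_form_of_eval_ne_zero (W := W) hA h0
    rw [inftyValuation_algebraMap, inftyIntValuation_apply, natDegree_eq_of_degree_eq_some this]
    intro h0
    have h1 : Module.Finite K[X] W.CoordinateRing :=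
      Module.Finite.of_basis (Affine.CoordinateRing.basis W)
    rw [h0, Algebra.norm_zero, degree_zero] at this
    exact WithBot.bot_ne_coe this
  | some x y h =>
    change (place h).valuation W.FunctionField _ = 1
    refine (place h).valuation_eq_one_iff_notMem.mpr fun hm => h0 ?_
    have := (mk_mem_XYIdeal_iff h.1 _).mp hm
    rwa [evalEval_aeval] at this

lemma aeval_form_ne_zero {P : W.Point} {B : MvPolynomial (Fin 3) K} {n : ℕ}
    (hB : B.IsHomogeneous n) (h0 : MvPolynomial.eval (projCoords P) B ≠ 0) :
    MvPolynomial.aeval ![xFun W, yFun W, 1] B ≠ 0 := by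
  intro h
  have h1 := val_form_eq hB h0
  rw [h, map_zero] at h1
  exact formVal_ne_zero n P h1.symm

/-- At an affine point, g is a fraction whose denominator does not vanish there, and its two terms
are made homogeneous of a common degree. At O, a fraction a / b is rewritten as a b² / b³: if b has
a pole of order m, then b³ has one of order 3m, so it is a form of degree m that does not vanish at
O. -/
lemma exists_forms_of_val_le_one {P : W.Point} {g : W.FunctionField} (hg : val P g ≤ 1) :
    ∃ (n : ℕ) (A B : MvPolynomial (Fin 3) K), A.IsHomogeneous n ∧ B.IsHomogeneous n ∧
      MvPolynomial.eval (projCoords P) B ≠ 0 ∧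
      g * MvPolynomial.aeval ![xFun W, yFun W, 1] B =
        MvPolynomial.aeval ![xFun W, yFun W, 1] A := by
  simp only [aeval_xy]
  cases P with
  | zero =>
    change inftyValuation W g ≤ 1 at hg
    obtain ⟨a, b, hb, rfl⟩ := IsFractionRing.div_surjective (A := W.CoordinateRing) g
    have hb := nonZeroDivisors.ne_zero hb
    have hbF : algebraMap W.CoordinateRing W.FunctionField b ≠ 0 := by simpa using hb
    set m := (Algebra.norm K[X] b).natDegree with hm
    have hvb : inftyIntValuation W b = exp (m : ℤ) := inftyIntValuation_apply hb
    rw [map_div₀, inftyValuation_algebraMap, inftyValuation_algebraMap, hvb,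
      div_le_one₀ exp_pos] at hg
    have hB : inftyIntValuation W (b ^ 3) = exp ((3 * m : ℕ) : ℤ) := by
      rw [map_pow, hvb, Nat.cast_mul, ← nsmul_eq_mul, exp_nsmul]
    have hA : inftyIntValuation W (a * b ^ 2) ≤ exp ((3 * m : ℕ) : ℤ) := by
      rw [← hB, pow_succ' b 2, map_mul, map_mul, hvb]
      gcongr
    have hlt : exp ((3 * m : ℕ) : ℤ) < exp ((3 * m + 1 : ℕ) : ℤ) := by
      rw [exp_lt_exp]; lia
    obtain ⟨B, hBn, hBb⟩ := isForm_of_degree_norm_lt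
      ((inftyIntValuation_lt_exp_iff _ _).mp (hB.trans_lt hlt))
    obtain ⟨A, hAn, hAa⟩ := isForm_of_degree_norm_lt
      ((inftyIntValuation_lt_exp_iff _ _).mp (hA.trans_lt hlt))
    refine ⟨m, A, B, hAn, hBn, ?_, ?_⟩
    · intro h0
      have := val_form_lt (P := (.zero : W.Point)) hBn h0
      rw [aeval_xy, hBb] at this
      change inftyValuation W _ < exp ((3 * m : ℕ) : ℤ) at this
      rw [inftyValuation_algebraMap] at this
      exact (hB ▸ this).false
    · rw [hAa, hBb, map_pow, map_mul, map_pow]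
      field_simp
  | some x y h =>
    change (place h).valuation W.FunctionField g ≤ 1 at hg
    obtain ⟨a, ⟨b, hb⟩, hab⟩ := (place h).exists_primeCompl_mul_eq_of_integer g hg
    obtain ⟨m, hm⟩ := exists_isForm a
    obtain ⟨n, hn⟩ := exists_isForm b
    obtain ⟨A, hA, rfl⟩ := hm.mono (le_max_left m n)
    obtain ⟨B, hB, rfl⟩ := hn.mono (le_max_right m n)
    refine ⟨_, A, B, hA, hB, ?_, hab⟩
    intro h0
    refine hb ((mk_mem_XYIdeal_iff h.1 _).mpr ?_)
    rw [evalEval_aeval]; exact h0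

lemma regularAt_iff {P : W.Point} {g : W.FunctionField} : RegularAt P g ↔ val P g ≤ 1 := by
  constructor
  · rintro ⟨c, n, A, B, hA, hB, hB0, rfl, rfl⟩
    rw [map_div₀, val_form_eq hB hB0, div_le_one₀ (zero_lt_iff.mpr (formVal_ne_zero n P))]
    by_cases h0 : MvPolynomial.eval (projCoords P) A = 0
    · exact (val_form_lt hA h0).le
    · exact (val_form_eq hA h0).le
  · intro h
    obtain ⟨n, A, B, hA, hB, hB0, h1⟩ := exists_forms_of_val_le_one h
    exact ⟨_, n, A, B, hA, hB, hB0, (eq_div_iff (aeval_form_ne_zero hB hB0)).mpr h1, rfl⟩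

lemma hasValueAt_iff {P : W.Point} {g : W.FunctionField} {c : K} :
    HasValueAt P g c ↔ val P (g - algebraMap K W.FunctionField c) < 1 := by
  constructor
  · rintro ⟨n, A, B, hA, hB, hB0, rfl, rfl⟩
    set c := MvPolynomial.eval (projCoords P) A / MvPolynomial.eval (projCoords P) B with hc
    have h1 := val_form_eq hB hB0
    have h0 := aeval_form_ne_zero hB hB0
    have hC : (A - MvPolynomial.C c * B).IsHomogeneous n := by
      refine hA.sub ?_
      simpa using (MvPolynomial.isHomogeneous_C (Fin 3) c).mul hB
    have h2 := val_form_lt (P := P) hC (by rw [map_sub, map_mul, MvPolynomial.eval_C, hc,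
      div_mul_cancel₀ _ hB0, sub_self])
    rw [map_sub, map_mul, MvPolynomial.aeval_C] at h2
    rw [div_sub' h0, map_div₀, h1, div_lt_one₀ (zero_lt_iff.mpr (formVal_ne_zero n P)), mul_comm]
    exact h2
  · intro h
    obtain ⟨n, A, B, hA, hB, hB0, h1⟩ := exists_forms_of_val_le_one h.le
    have h0 := aeval_form_ne_zero hB hB0
    have hA0 : MvPolynomial.eval (projCoords P) A = 0 := by
      by_contra hA0
      have := congrArg (val P) h1
      rw [map_mul, val_form_eq hA hA0, val_form_eq hB hB0,
        mul_eq_right₀ (formVal_ne_zero n P)] at this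
      exact h.ne this
    refine ⟨n, A + MvPolynomial.C c * B, B, hA.add ?_, hB, hB0, ?_, ?_⟩
    · simpa using (MvPolynomial.isHomogeneous_C (Fin 3) c).mul hB
    · rw [map_add, map_mul, MvPolynomial.aeval_C, ← h1]
      field_simp
      ring
    · rw [map_add, map_mul, MvPolynomial.eval_C, hA0, zero_add, mul_div_cancel_right₀ _ hB0]

lemma hasValueAt_zero_iff {P : W.Point} {g : W.FunctionField} :
    HasValueAt P g 0 ↔ val P g < 1 := by
  rw [hasValueAt_iff, map_zero, sub_zero]

lemma val_xFun_zero : val (0 : W.Point) (xFun W) = exp 2 := by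
  have := degree_norm_x_pow_mul_y_pow (W := W) 1 0
  rw [pow_one, pow_zero, mul_one] at this
  rw [val_zero, xFun, inftyValuation_algebraMap, inftyIntValuation_apply,
    natDegree_eq_of_degree_eq_some this]
  · rfl
  · simpa [Affine.CoordinateRing.XClass] using Affine.CoordinateRing.XClass_ne_zero (W' := W) 0

lemma val_yFun_zero : val (0 : W.Point) (yFun W) = exp 3 := by
  have := degree_norm_x_pow_mul_y_pow (W := W) 0 1
  rw [pow_one, pow_zero, one_mul] at this
  rw [val_zero, yFun, inftyValuation_algebraMap, inftyIntValuation_apply,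
    natDegree_eq_of_degree_eq_some this]
  · rfl
  · simpa [Affine.CoordinateRing.YClass] using Affine.CoordinateRing.YClass_ne_zero (W' := W) 0

lemma exists_val_eq_exp (P : W.Point) : ∃ t : W.FunctionField, val P t = exp (-1 : ℤ) := by
  cases P with
  | zero =>
    refine ⟨xFun W / yFun W, ?_⟩
    rw [map_div₀]
    change val 0 _ / val 0 _ = _
    rw [val_xFun_zero, val_yFun_zero, ← exp_sub]
    norm_num
  | some x y h => exact (place h).valuation_exists_uniformizer W.FunctionField

/-- The maximality built into `IsUniformizer` is tested against a function already known to have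
order one. -/
lemma isUniformizer_iff {P : W.Point} {t : W.FunctionField} :
    IsUniformizer P t ↔ val P t = exp (-1 : ℤ) := by
  constructor
  · rintro ⟨h0, h1, h2⟩
    obtain ⟨s, hs⟩ := exists_val_eq_exp P
    have hv0 : val P t ≠ 0 := (Valuation.ne_zero_iff _).mpr h0
    have h3 := h2 s (hasValueAt_zero_iff.mpr (by rw [hs, ← exp_zero, exp_lt_exp]; simp))
    rw [hasValueAt_zero_iff, ← exp_log hv0, ← exp_zero, exp_lt_exp] at h1
    rw [regularAt_iff, map_div₀, hs, div_le_one₀ (zero_lt_iff.mpr hv0), ← exp_log hv0,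
      exp_le_exp] at h3
    rw [← exp_log hv0, exp_inj]
    lia
  · intro h
    have hv0 : val P t ≠ 0 := h ▸ exp_ne_zero
    refine ⟨(Valuation.ne_zero_iff _).mp hv0,
      hasValueAt_zero_iff.mpr (by rw [h, ← exp_zero, exp_lt_exp]; simp), fun g hg => ?_⟩
    rw [regularAt_iff, map_div₀, h, div_le_one₀ exp_pos]
    by_cases hg0 : val P g = 0
    · simp [hg0]
    rw [hasValueAt_zero_iff, ← exp_log hg0, ← exp_zero, exp_lt_exp] at hg
    rw [← exp_log hg0, exp_le_exp]
    lia

lemma exists_isUniformizer (P : W.Point) : ∃ t : W.FunctionField, IsUniformizer P t :=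
  (exists_val_eq_exp P).imp fun _ => isUniformizer_iff.mpr

/-- The set in the definition of `ord` is a ray bounded above by -log of the valuation, whichever
uniformizer is used, so its supremum is attained. -/
lemma ord_eq (P : W.Point) {g : W.FunctionField} (hg : g ≠ 0) : ord P g = -log (val P g) := by
  have hv0 : val P g ≠ 0 := (Valuation.ne_zero_iff _).mpr hg
  have : {n : ℤ | ∃ t, IsUniformizer P t ∧ RegularAt P (g / t ^ n)} = Set.Iic (-log (val P g)) := by
    ext n
    have key (t : W.FunctionField) (ht : val P t = exp (-1 : ℤ)) :
        val P (g / t ^ n) ≤ 1 ↔ n ≤ -log (val P g) := by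
      rw [map_div₀, map_zpow₀, ht, ← exp_zsmul, div_le_one₀ exp_pos]
      nth_rw 1 [← exp_log hv0]
      rw [exp_le_exp, smul_eq_mul]
      lia
    simp only [isUniformizer_iff, regularAt_iff, Set.mem_Iic]
    constructor
    · rintro ⟨t, ht, h⟩
      exact (key t ht).mp h
    · intro h
      obtain ⟨t, ht⟩ := exists_val_eq_exp P
      exact ⟨t, ht, (key t ht).mpr h⟩
  rw [ord, this, csSup_Iic]

lemma val_eq_exp_neg_ord (P : W.Point) {g : W.FunctionField} (hg : g ≠ 0) :
    val P g = exp (-ord P g) := by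
  rw [ord_eq P hg, neg_neg, exp_log ((Valuation.ne_zero_iff _).mpr hg)]

lemma ord_mul (P : W.Point) {g h : W.FunctionField} (hg : g ≠ 0) (hh : h ≠ 0) :
    ord P (g * h) = ord P g + ord P h := by
  rw [ord_eq P hg, ord_eq P hh, ord_eq P (mul_ne_zero hg hh), map_mul,
    log_mul ((Valuation.ne_zero_iff _).mpr hg) ((Valuation.ne_zero_iff _).mpr hh)]
  ring

lemma ord_inv (P : W.Point) {g : W.FunctionField} (hg : g ≠ 0) : ord P g⁻¹ = -ord P g := by
  rw [ord_eq P hg, ord_eq P (inv_ne_zero hg), map_inv₀, log_inv]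

lemma ord_pos_iff {P : W.Point} {g : W.FunctionField} (hg : g ≠ 0) :
    0 < ord P g ↔ HasValueAt P g 0 := by
  rw [hasValueAt_zero_iff, val_eq_exp_neg_ord P hg, ← exp_zero, exp_lt_exp]
  lia

lemma ord_nonneg_iff {P : W.Point} {g : W.FunctionField} (hg : g ≠ 0) :
    0 ≤ ord P g ↔ val P g ≤ 1 := by
  rw [val_eq_exp_neg_ord P hg, ← exp_zero, exp_le_exp]
  lia

lemma finite_ord_ne_zero {g : W.FunctionField} (hg : g ≠ 0) : {P | ord P g ≠ 0}.Finite := by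
  refine ((finite_zeros hg).union (finite_zeros (inv_ne_zero hg))).subset fun P hP => ?_
  rcases lt_or_gt_of_ne hP with h | h
  · exact .inr ((ord_pos_iff (inv_ne_zero hg)).mp (by rw [ord_inv P hg]; lia))
  · exact .inl ((ord_pos_iff hg).mp h)

/-- The divisor of a nonzero rational function. -/
def divisor {g : W.FunctionField} (hg : g ≠ 0) : Divisor W :=
  Finsupp.ofSupportFinite (fun P => ord P g) (finite_ord_ne_zero hg)

lemma divisor_apply {g : W.FunctionField} (hg : g ≠ 0) (P : W.Point) :
    divisor hg P = ord P g := rfl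

lemma isDivisorOf_iff {g : W.FunctionField} (hg : g ≠ 0) (D : Divisor W) :
    IsDivisorOf g D ↔ divisor hg = D :=
  ⟨fun h => Finsupp.ext h.2, fun h => ⟨hg, fun P => h ▸ (divisor_apply hg P).symm⟩⟩

end Valuations

end

end EllipticIsogeny

namespace EllipticIsogeny

open WeierstrassCurve Polynomial IsDedekindDomain nonZeroDivisors WithZero

noncomputable section

/-! ### Divisors, fractional ideals and the class group -/

section DedekindDomain

variable {R : Type*} [CommRing R] [IsDedekindDomain R] {F : Type*} [Field F] [Algebra R F]
  [IsFractionRing R F]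

lemma count_spanSingleton (v : HeightOneSpectrum R) {g : F} (hg : g ≠ 0) :
    FractionalIdeal.count F v (FractionalIdeal.spanSingleton R⁰ g) = -log (v.valuation F g) := by
  have key (a : R) (ha : a ≠ 0) : FractionalIdeal.count F v
      (FractionalIdeal.spanSingleton R⁰ (algebraMap R F a)) =
      -log (v.valuation F (algebraMap R F a)) := by
    rw [← FractionalIdeal.coeIdeal_span_singleton,
      FractionalIdeal.count_coe _ _ (by simpa using ha),
      v.valuation_of_algebraMap, v.intValuation_if_neg ha, log_exp, neg_neg]
  obtain ⟨a, b, hb, rfl⟩ := IsFractionRing.div_surjective (A := R) g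
  have hb' : algebraMap R F b ≠ 0 := by simpa using nonZeroDivisors.ne_zero hb
  have ha' : algebraMap R F a ≠ 0 := (div_ne_zero_iff.mp hg).1
  have ha : a ≠ 0 := by simpa using ha'
  have h1 := key a ha
  rw [← div_mul_cancel₀ (algebraMap R F a) hb', ← FractionalIdeal.spanSingleton_mul_spanSingleton,
    FractionalIdeal.count_mul _ _ (FractionalIdeal.spanSingleton_ne_zero_iff.mpr hg)
      (FractionalIdeal.spanSingleton_ne_zero_iff.mpr hb'), key b (nonZeroDivisors.ne_zero hb),
    map_mul, log_mul ((Valuation.ne_zero_iff _).mpr hg) ((Valuation.ne_zero_iff _).mpr hb')] at h1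
  lia

lemma fractionalIdeal_eq_of_count_eq {I J : FractionalIdeal R⁰ F} (hI : I ≠ 0) (hJ : J ≠ 0)
    (h : ∀ v : HeightOneSpectrum R, FractionalIdeal.count F v I = FractionalIdeal.count F v J) :
    I = J := by
  rw [← FractionalIdeal.finprod_heightOneSpectrum_factorization' F hI,
    ← FractionalIdeal.finprod_heightOneSpectrum_factorization' F hJ]
  simp_rw [h]

end DedekindDomain

section Residue

universe u

/-- The residue extension is integral over an algebraically closed field, hence trivial. -/
lemma inertiaDeg_eq_one {R K : Type u} {S : Type*} [CommRing R] [CommRing S] [Algebra R S]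
    [Algebra.IsIntegral R S] (p : Ideal R) (P : Ideal S) [P.LiesOver p] [p.IsMaximal]
    [P.IsMaximal] [Field K] [IsAlgClosed K] (φ : (R ⧸ p) ≃+* K) :
    P.inertiaDeg R = 1 := by
  rw [Ideal.inertiaDeg_eq_of_isMaximal p P]
  let := Ideal.Quotient.field p
  let := Ideal.Quotient.field P
  have : IsAlgClosed (R ⧸ p) := IsAlgClosed.of_ringEquiv K (R ⧸ p) φ.symm
  have : Function.Surjective (algebraMap (R ⧸ p) (S ⧸ P)) :=
    (IsAlgClosed.algebraMap_bijective_of_isIntegral).surjective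
  exact finrank_eq_one_iff'.mpr ⟨1, one_ne_zero, fun w => by
    obtain ⟨c, hc⟩ := this w
    exact ⟨c, by rw [← hc, Algebra.algebraMap_eq_smul_one]⟩⟩

end Residue

section Abel

variable {K : Type*} [Field K] {W : Affine K}

/-- The invertible fractional ideal of an affine point; the unit ideal at infinity. -/
def pointIdeal : W.Point → (FractionalIdeal W.CoordinateRing⁰ W.FunctionField)ˣ
  | .zero => 1
  | .some _ _ h => Affine.CoordinateRing.XYIdeal' h

lemma toClass_eq [DecidableEq K] (P : W.Point) :
    Affine.Point.toClass P = Additive.ofMul (ClassGroup.mk W.FunctionField (pointIdeal P)) := by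
  cases P with
  | zero => exact (congrArg Additive.ofMul (map_one (ClassGroup.mk W.FunctionField))).symm
  | some x y h => rfl

/-- The fractional ideal of a divisor. -/
def divisorIdeal (D : Divisor W) : (FractionalIdeal W.CoordinateRing⁰ W.FunctionField)ˣ :=
  D.prod fun P n => pointIdeal P ^ n

/-- `toClass` is a homomorphism, so adding points of the curve is multiplying ideal classes. -/
lemma toClass_sum [DecidableEq K] (D : Divisor W) :
    Affine.Point.toClass (D.sum fun P n => n • P) =
      Additive.ofMul (ClassGroup.mk W.FunctionField (divisorIdeal D)) := by
  rw [map_finsuppSum, divisorIdeal, map_finsuppProd, Finsupp.sum, Finsupp.prod, ofMul_prod]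
  exact Finset.sum_congr rfl fun P _ => by rw [map_zsmul, toClass_eq, map_zpow, ofMul_zpow]

variable [IsAlgClosed K] [W.IsElliptic]

lemma count_pointIdeal [DecidableEq W.Point] {x y : K} (h : W.Nonsingular x y) (P : W.Point) :
    FractionalIdeal.count W.FunctionField (place h) (pointIdeal P).1 =
      if P = .some x y h then 1 else 0 := by
  cases P with
  | zero =>
    rw [if_neg (by rintro ⟨⟩)]
    exact FractionalIdeal.count_one W.FunctionField (place h)
  | some x' y' h' =>
    change FractionalIdeal.count W.FunctionField (place h)
      ((place h').asIdeal : FractionalIdeal W.CoordinateRing⁰ W.FunctionField) = _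
    classical
    rw [FractionalIdeal.count_maximal]
    congr 1
    refine propext ⟨fun he => ?_, ?_⟩
    · obtain ⟨rfl, rfl⟩ := XYIdeal_injective h'.1 h.1 (congrArg HeightOneSpectrum.asIdeal he)
      rfl
    · rintro ⟨⟩
      rfl

lemma count_divisorIdeal {x y : K} (h : W.Nonsingular x y) (D : Divisor W) :
    FractionalIdeal.count W.FunctionField (place h) (divisorIdeal D).1 = D (.some x y h) := by
  classical
  have : (divisorIdeal D).1 = ∏ P ∈ D.support, (pointIdeal P).1 ^ D P := by
    rw [divisorIdeal, Finsupp.prod, Units.coe_prod]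
    exact Finset.prod_congr rfl fun P _ => Units.val_zpow_eq_zpow_val _ _
  rw [this, FractionalIdeal.count_prod _ _ _ _ fun P _ => zpow_ne_zero _ (Units.ne_zero _)]
  simp_rw [FractionalIdeal.count_zpow, count_pointIdeal]
  simp only [mul_ite, mul_one, mul_zero, Finset.sum_ite_eq', Finsupp.mem_support_iff]
  split_ifs with h0
  · rfl
  · exact (not_not.mp h0).symm

/-- A fractional ideal is determined by its multiplicities at the primes, which are the affine
points. The coefficient of D at O is invisible. -/
lemma divisorIdeal_eq_spanSingleton_iff (D : Divisor W) {g : W.FunctionField} (hg : g ≠ 0) :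
    (divisorIdeal D).1 = FractionalIdeal.spanSingleton W.CoordinateRing⁰ g ↔
      ∀ P ≠ 0, ord P g = D P := by
  have key {x y : K} (h : W.Nonsingular x y) : FractionalIdeal.count W.FunctionField (place h)
      (FractionalIdeal.spanSingleton W.CoordinateRing⁰ g) = ord (.some x y h) g := by
    rw [count_spanSingleton _ hg, ord_eq _ hg, val_some]
  constructor
  · rintro he (_ | ⟨x, y, h⟩) hP
    · exact (hP rfl).elim
    · rw [← key, ← he, count_divisorIdeal]
  · intro h
    refine fractionalIdeal_eq_of_count_eq (Units.ne_zero _)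
      (FractionalIdeal.spanSingleton_ne_zero_iff.mpr hg) fun v => ?_
    obtain ⟨x, y, hP, rfl⟩ := exists_eq_place v
    rw [count_divisorIdeal, key, h _ (Affine.Point.some_ne_zero hP)]

/-- Abel's theorem without the condition at O: since `toClass` is injective, the sum vanishes
exactly when the fractional ideal of D is principal. -/
lemma sum_zsmul_eq_zero_iff [DecidableEq K] (D : Divisor W) :
    (D.sum fun P n => n • P) = 0 ↔ ∃ g : W.FunctionField, g ≠ 0 ∧ ∀ P ≠ 0, ord P g = D P := by
  rw [← Affine.Point.toClass_eq_zero, toClass_sum, ofMul_eq_zero, ClassGroup.mk_eq_one_iff]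
  constructor
  · rintro ⟨g, hg⟩
    have he : (divisorIdeal D).1 = FractionalIdeal.spanSingleton W.CoordinateRing⁰ g :=
      FractionalIdeal.coeToSubmodule_injective 
        (hg.trans (FractionalIdeal.coe_spanSingleton _ g).symm)
    have hg0 : g ≠ 0 := by
      rintro rfl
      rw [FractionalIdeal.spanSingleton_zero] at he
      exact Units.ne_zero _ he
    exact ⟨g, hg0, (divisorIdeal_eq_spanSingleton_iff D hg0).mp he⟩
  · rintro ⟨g, hg0, h⟩
    rw [(divisorIdeal_eq_spanSingleton_iff D hg0).mpr h, FractionalIdeal.coe_spanSingleton]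
    exact ⟨g, rfl⟩

end Abel


end

end EllipticIsogeny

namespace EllipticIsogeny

open WeierstrassCurve Polynomial IsDedekindDomain nonZeroDivisors WithZero

noncomputable section

/-! ### Principal divisors have degree zero; Abel's theorem -/

section Degree

variable {K : Type*} [Field K] {W : Affine K}

instance : Module.Finite K[X] W.CoordinateRing :=
  Module.Finite.of_basis (Affine.CoordinateRing.basis W)

/-- The maximal ideal of an affine point; the unit ideal at infinity. -/
def pointMaximal : W.Point → Ideal W.CoordinateRing
  | .zero => ⊤
  | .some x y _ => Affine.CoordinateRing.XYIdeal W x (C y)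

lemma coe_pointMaximal (P : W.Point) :
    (pointMaximal P : FractionalIdeal W.CoordinateRing⁰ W.FunctionField) = pointIdeal P := by
  cases P with
  | zero => exact FractionalIdeal.coeIdeal_top ..
  | some x y h => rfl

/-- The polynomial `X - x(P)` of an affine point; the constant `1` at infinity. -/
def pointPoly : W.Point → K[X]
  | .zero => 1
  | .some x _ _ => X - C x

variable [IsAlgClosed K] [W.IsElliptic]

/-- The point (x, y) lies over the prime X - x of K[X] with inertia degree one. -/
lemma relNorm_pointMaximal [CharZero K] (P : W.Point) :
    Ideal.relNorm K[X] (pointMaximal P) = Ideal.span {pointPoly P} := by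
  cases P with
  | zero =>
    change Ideal.relNorm K[X] ⊤ = Ideal.span {1}
    rw [Ideal.relNorm_top, Ideal.span_singleton_one]
  | some x y h =>
    change Ideal.relNorm K[X] (Affine.CoordinateRing.XYIdeal W x (C y)) = Ideal.span {X - C x}
    have hP := isMaximal_XYIdeal h.1
    have hp : (Ideal.span {X - C x} : Ideal K[X]).IsMaximal :=
      PrincipalIdealRing.isMaximal_of_irreducible (irreducible_X_sub_C x)
    have : (Affine.CoordinateRing.XYIdeal W x (C y)).LiesOver (Ideal.span {X - C x}) := by
      refine ⟨hp.eq_of_le ?_ ?_⟩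
      · exact Ideal.comap_ne_top _ hP.ne_top
      · rw [Ideal.span_singleton_le_iff_mem]
        exact Ideal.subset_span (.inl rfl)
    have : CharZero (FractionRing K[X]) := by infer_instance
    rw [Ideal.relNorm_eq_pow_of_isMaximal _ (Ideal.span {X - C x}), inertiaDeg_eq_one
      (Ideal.span {X - C x}) _ (quotientSpanXSubCAlgEquiv x).toRingEquiv, pow_one]

lemma span_singleton_eq_prod {a : W.CoordinateRing}
    (hF : algebraMap W.CoordinateRing W.FunctionField a ≠ 0) :
    Ideal.span {a} = ∏ P ∈ (divisor hF).support, pointMaximal P ^ (divisor hF P).toNat := by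
  rw [← FractionalIdeal.coeIdeal_inj (K := W.FunctionField),
    FractionalIdeal.coeIdeal_span_singleton,
    ← (divisorIdeal_eq_spanSingleton_iff (divisor hF) hF).mpr fun P _ => rfl,
    divisorIdeal, Finsupp.prod, Units.coe_prod]
  refine Eq.trans ?_
    (map_prod (FractionalIdeal.coeIdealHom W.CoordinateRing⁰ W.FunctionField) _ _).symm
  refine Finset.prod_congr rfl fun P _ => ?_
  rw [FractionalIdeal.coeIdealHom_apply, FractionalIdeal.coeIdeal_pow, coe_pointMaximal,
    ← zpow_natCast, Units.val_zpow_eq_zpow_val]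
  cases P with
  | zero => simp [pointIdeal]
  | some x y h =>
    rw [Int.toNat_of_nonneg]
    rw [divisor_apply, ord_nonneg_iff hF, val_some]
    exact (place h).valuation_le_one _

/-- Take norms to K[X] in the factorization of (a): the norm of a is, up to a unit, the product of
the X - x(P) to the power ord_P(a). Its degree is the number of affine zeros and also the order of
the pole at O. -/
lemma sum_divisor_algebraMap [CharZero K] {a : W.CoordinateRing} (ha : a ≠ 0)
    (hF : algebraMap W.CoordinateRing W.FunctionField a ≠ 0) :
    ((divisor hF).sum fun _ n => n) = 0 := by
  classical
  have h1 := congrArg (Ideal.relNorm K[X]) (span_singleton_eq_prod hF)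
  rw [Ideal.relNorm_singleton, map_prod, Algebra.intNorm_eq_norm] at h1
  simp_rw [map_pow, relNorm_pointMaximal, Ideal.span_singleton_pow,
    Ideal.prod_span_singleton, Ideal.span_singleton_eq_span_singleton] at h1
  have h2 := natDegree_eq_of_degree_eq (degree_eq_degree_of_associated h1)
  have hne (P : W.Point) : pointPoly P ≠ 0 := by
    cases P with
    | zero => exact one_ne_zero
    | some x y h => exact X_sub_C_ne_zero x
  rw [natDegree_prod _ _ fun P _ => pow_ne_zero _ (hne P)] at h2
  have h3 : ord (0 : W.Point) (algebraMap W.CoordinateRing W.FunctionField a) =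
      -(Algebra.norm K[X] a).natDegree := by
    rw [ord_eq _ hF, val_zero, inftyValuation_algebraMap, inftyIntValuation_apply ha, log_exp]
  -- O is inserted into the support so that its term can be split off even when it is zero; on the
  -- side of the norm it contributes nothing, `pointPoly` being 1 there.
  rw [Finsupp.sum_of_support_subset _ (s := insert 0 (divisor hF).support)
    (Finset.subset_insert _ _) _ (by simp), ← Finset.sum_erase_add _ _ (Finset.mem_insert_self _ _),
    divisor_apply, h3, h2, Finset.erase_insert_eq_erase, Nat.cast_sum]
  rw [← Finset.sum_erase (a := (0 : W.Point)) (f := fun P => ((pointPoly P ^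
    (divisor hF P).toNat).natDegree : ℤ)), ← sub_eq_add_neg, sub_eq_zero]
  · refine Finset.sum_congr rfl fun P hP => ?_
    cases P with
    | zero => exact (Finset.notMem_erase _ _ hP).elim
    | some x y h =>
      change _ = (((X - C x) ^ _).natDegree : ℤ)
      rw [natDegree_pow, natDegree_X_sub_C, mul_one, Int.toNat_of_nonneg]
      rw [divisor_apply, ord_nonneg_iff hF, val_some]
      exact (place h).valuation_le_one _
  · change (((1 : K[X]) ^ _).natDegree : ℤ) = 0
    simp

/-- Principal divisors have degree zero. -/
lemma sum_divisor [CharZero K] {g : W.FunctionField} (hg : g ≠ 0) :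
    ((divisor hg).sum fun _ n => n) = 0 := by
  obtain ⟨a, b, hb, rfl⟩ := IsFractionRing.div_surjective (A := W.CoordinateRing) g
  have hb0 := nonZeroDivisors.ne_zero hb
  have hb' : algebraMap W.CoordinateRing W.FunctionField b ≠ 0 := by simpa using hb0
  have ha' : algebraMap W.CoordinateRing W.FunctionField a ≠ 0 := (div_ne_zero_iff.mp hg).1
  have ha : a ≠ 0 := by simpa using ha'
  have : divisor hg = divisor ha' - divisor hb' := by
    ext P
    rw [Finsupp.sub_apply, divisor_apply, divisor_apply, divisor_apply, div_eq_mul_inv,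
      ord_mul P ha' (inv_ne_zero hb'), ord_inv P hb', sub_eq_add_neg]
  rw [this, Finsupp.sum_sub_index (by simp), sum_divisor_algebraMap ha, sum_divisor_algebraMap hb0,
    sub_zero]

/-- Abel's theorem. -/
lemma exists_isDivisorOf_iff [CharZero K] [DecidableEq K] (D : Divisor W) :
    (∃ g : W.FunctionField, IsDivisorOf g D) ↔
      (D.sum fun _ n => n) = 0 ∧ (D.sum fun P n => n • P) = 0 := by
  constructor
  · rintro ⟨g, hg⟩
    refine ⟨?_, (sum_zsmul_eq_zero_iff D).mpr ⟨g, hg.1, fun P _ => hg.2 P⟩⟩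
    rw [← (isDivisorOf_iff hg.1 D).mp hg, sum_divisor]
  · rintro ⟨h0, h1⟩
    obtain ⟨g, hg, h2⟩ := (sum_zsmul_eq_zero_iff D).mp h1
    refine ⟨g, hg, fun P => ?_⟩
    by_cases hP : P = 0
    -- The two divisors agree away from O and both have degree zero, so they agree at O.
    · have h3 : divisor hg - D = Finsupp.single 0 (divisor hg 0 - D 0) := by
        ext Q
        by_cases hQ : Q = 0
        · simp [hQ]
        · rw [Finsupp.single_eq_of_ne hQ, Finsupp.sub_apply, divisor_apply, h2 Q hQ, sub_self]
      have h4 := congrArg (fun E : Divisor W => E.sum fun _ n => n) h3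
      rw [Finsupp.sum_sub_index (by simp), sum_divisor, h0, Finsupp.sum_single_index rfl] at h4
      rw [hP, ← divisor_apply hg]
      lia
    · exact h2 P hP

end Degree

end

end EllipticIsogeny

namespace EllipticIsogeny

open WeierstrassCurve Polynomial IsDedekindDomain nonZeroDivisors WithZero

noncomputable section

/-! ### Discrete valuations of the function field come from points -/

section DiscreteValuations

/-- Units for v are units for w, so log w is an integer multiple of log v. Normalization of w makes
the factor ±1, and the inclusion of valuation rings excludes -1. -/
lemma valuation_eq_of_le {L : Type*} [Field L] {v w : Valuation L ℤᵐ⁰}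
    (hv : ∃ t, v t = exp (-1 : ℤ)) (hw : ∃ t, w t = exp (-1 : ℤ))
    (h : ∀ g, v g ≤ 1 → w g ≤ 1) : v = w := by
  obtain ⟨t, ht⟩ := hv
  obtain ⟨s, hs⟩ := hw
  have ht0 : t ≠ 0 := by rintro rfl; rw [map_zero] at ht; exact exp_ne_zero ht.symm
  have hs0 : s ≠ 0 := by rintro rfl; rw [map_zero] at hs; exact exp_ne_zero hs.symm
  have hwt : w t ≠ 0 := (Valuation.ne_zero_iff _).mpr ht0
  have hunit (g : L) (hg : v g = 1) : w g = 1 := by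
    refine le_antisymm (h g hg.le) ?_
    have h1 := h g⁻¹ (by rw [map_inv₀, hg, inv_one])
    have hg0 : w g ≠ 0 := (Valuation.ne_zero_iff _).mpr (by rintro rfl; simp at hg)
    rwa [map_inv₀, inv_le_one₀ (zero_lt_iff.mpr hg0)] at h1
  have key (g : L) (hg : g ≠ 0) : log (w g) = -log (v g) * log (w t) := by
    have hvg : v g ≠ 0 := (Valuation.ne_zero_iff _).mpr hg
    have hwg : w g ≠ 0 := (Valuation.ne_zero_iff _).mpr hg
    have h1 := hunit (g * t ^ log (v g)) (by
      rw [map_mul, map_zpow₀, ht, ← exp_zsmul]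
      nth_rw 1 [← exp_log hvg]
      rw [← exp_add, smul_eq_mul, mul_neg_one, add_neg_cancel, exp_zero])
    have h2 := congrArg log h1
    rw [map_mul, map_zpow₀, log_mul hwg (zpow_ne_zero _ hwt), log_zpow, log_one, smul_eq_mul] at h2
    linarith
  have hle : log (w t) ≤ 0 := by
    have := h t (by rw [ht, ← exp_zero, exp_le_exp]; simp)
    rwa [← log_le_log hwt one_ne_zero, log_one] at this
  have h1 : log (w t) = -1 := by
    have h2 := key s hs0
    rw [hs, log_exp, neg_mul] at h2
    have h3 : log (v s) * log (w t) = 1 := by lia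
    rcases Int.eq_one_or_neg_one_of_mul_eq_one' h3 with h | h <;> lia
  ext g
  by_cases hg : g = 0
  · simp [hg]
  have hvg : v g ≠ 0 := (Valuation.ne_zero_iff _).mpr hg
  have hwg : w g ≠ 0 := (Valuation.ne_zero_iff _).mpr hg
  rw [← exp_log hvg, ← exp_log hwg, key g hg, h1]
  simp

/-- A valuation ring is integrally closed. -/
lemma valuation_le_one_of_isIntegral {R L Γ : Type*} [CommRing R] [Field L] [Algebra R L]
    [LinearOrderedCommGroupWithZero Γ] (w : Valuation L Γ) (h : ∀ r, w (algebraMap R L r) ≤ 1)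
    {g : L} (hg : IsIntegral R g) : w g ≤ 1 := by
  let φ : R →+* w.integer := (algebraMap R L).codRestrict w.integer h
  let := φ.toAlgebra
  have : IsScalarTower R w.integer L := IsScalarTower.of_algebraMap_eq fun _ => rfl
  exact (Valuation.integer.integers w).mem_of_integral (hg.tower_top (A := w.integer))

/-- The prime is the centre of w, the elements of R with w < 1. Functions integral at it are
fractions with denominator outside it, hence integral for w, and `valuation_eq_of_le` applies. -/
lemma exists_eq_valuation {R L : Type*} [CommRing R] [IsDedekindDomain R] [Field L] [Algebra R L]
    [IsFractionRing R L] {w : Valuation L ℤᵐ⁰} (hw : ∃ t, w t = exp (-1 : ℤ))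
    (h : ∀ r, w (algebraMap R L r) ≤ 1) : ∃ v : HeightOneSpectrum R, w = v.valuation L := by
  let p : Ideal R :=
    { carrier := {r | w (algebraMap R L r) < 1}
      zero_mem' := by simp
      add_mem' := fun ha hb => by
        change w _ < 1
        rw [map_add]
        exact w.map_add_lt ha hb
      smul_mem' := fun c a ha => by
        change w _ < 1
        rw [smul_eq_mul, map_mul, map_mul, mul_comm]
        exact mul_lt_one_of_lt_of_le ha (h c) }
  have hmem (r : R) : r ∈ p ↔ w (algebraMap R L r) < 1 := Iff.rfl
  have hp : p.IsPrime := by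
    refine Ideal.isPrime_iff.mpr ⟨fun ht => ?_, fun {a b} hab => ?_⟩
    · have := (hmem 1).mp (ht ▸ Submodule.mem_top)
      simp at this
    · by_contra! hc
      simp only [hmem, not_lt] at hc hab
      rw [map_mul, map_mul, (h a).antisymm hc.1, (h b).antisymm hc.2, mul_one] at hab
      exact hab.false
  have hp0 : p ≠ ⊥ := by
    obtain ⟨t, ht⟩ := hw
    obtain ⟨a, b, hb, rfl⟩ := IsFractionRing.div_surjective (A := R) t
    have ha : a ∈ p := by
      rw [hmem]
      have hb' : w (algebraMap R L b) ≠ 0 :=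
        (Valuation.ne_zero_iff _).mpr (by simpa using nonZeroDivisors.ne_zero hb)
      rw [map_div₀, div_eq_iff hb'] at ht
      rw [ht]
      exact mul_lt_one_of_lt_of_le (by rw [← exp_zero, exp_lt_exp]; simp) (h b)
    rintro hbot
    rw [hbot, Ideal.mem_bot] at ha
    rw [ha, map_zero, zero_div, map_zero] at ht
    exact exp_ne_zero ht.symm
  refine ⟨⟨p, hp, hp0⟩, (valuation_eq_of_le (HeightOneSpectrum.valuation_exists_uniformizer L _) hw
    fun g hg => ?_).symm⟩
  obtain ⟨a, ⟨b, hb⟩, hab⟩ := HeightOneSpectrum.exists_primeCompl_mul_eq_of_integer _ g hg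
  have hb1 : w (algebraMap R L b) = 1 := (h b).antisymm (not_lt.mp hb)
  have h1 := congrArg w hab
  rw [map_mul, hb1, mul_one] at h1
  rw [h1]
  exact h a

end DiscreteValuations

section Classification

lemma aeval_mul_of_isHomogeneous {K L : Type*} [Field K] [Field L] [Algebra K L]
    {A : MvPolynomial (Fin 3) K} {n : ℕ} (hA : A.IsHomogeneous n) (c : L) (v : Fin 3 → L) :
    MvPolynomial.aeval (fun i => c * v i) A = c ^ n * MvPolynomial.aeval v A := by
  rw [MvPolynomial.aeval_def, MvPolynomial.aeval_def, MvPolynomial.eval₂_eq',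
    MvPolynomial.eval₂_eq', Finset.mul_sum]
  refine Finset.sum_congr rfl fun d hd => ?_
  have hsum : ∑ i, d i = n := by
    have := hA (MvPolynomial.mem_support_iff.mp hd)
    rw [Finsupp.weight_apply, Finsupp.sum_fintype _ _ (by simp)] at this
    simpa using this
  simp_rw [mul_pow]
  rw [Finset.prod_mul_distrib, Finset.prod_pow_eq_pow_sum, hsum]
  ring

variable {K : Type*} [Field K] {W : Affine K}

lemma xFun_yFun_equation : yFun W ^ 2 + algebraMap K W.FunctionField W.a₁ * xFun W * yFun W +
    algebraMap K W.FunctionField W.a₃ * yFun W = xFun W ^ 3 +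
    algebraMap K W.FunctionField W.a₂ * xFun W ^ 2 + algebraMap K W.FunctionField W.a₄ * xFun W +
    algebraMap K W.FunctionField W.a₆ := by
  let φ : K[X][X] →+* W.FunctionField :=
    (algebraMap W.CoordinateRing W.FunctionField).comp (Affine.CoordinateRing.mk W)
  have h : φ (X ^ 2 + C (C W.a₁ * X + C W.a₃) * X -
      C (X ^ 3 + C W.a₂ * X ^ 2 + C W.a₄ * X + C W.a₆)) = 0 := by
    change φ W.polynomial = 0
    rw [RingHom.comp_apply, show Affine.CoordinateRing.mk W W.polynomial = 0 from
      AdjoinRoot.mk_self, map_zero]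
  have h1 (c : K) : algebraMap K W.FunctionField c = φ (C (C c)) := rfl
  rw [h1, h1, h1, h1, h1, show xFun W = φ (C X) from rfl, show yFun W = φ X from rfl,
    ← sub_eq_zero, ← h]
  simp only [map_add, map_sub, map_mul, map_pow]
  ring

variable [IsAlgClosed K] [W.IsElliptic]

/-- Every discrete valuation of the function field that is trivial on constants comes from a
point. -/
lemma exists_eq_val {w : Valuation W.FunctionField ℤᵐ⁰} (hw : ∃ t, w t = exp (-1 : ℤ))
    (hK : ∀ c : K, w (algebraMap K W.FunctionField c) ≤ 1) : ∃ P : W.Point, w = val P := by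
  -- If x is integral for w, so is the coordinate ring, which is integral over K[x], and w is
  -- centred at an affine point. Otherwise w must be the valuation at O.
  by_cases hx : w (xFun W) ≤ 1
  · have hpoly (p : K[X]) : w (algebraMap K[X] W.FunctionField p) ≤ 1 := by
      induction p using Polynomial.induction_on' with
      | add p q hp hq => rw [map_add]; exact w.map_add_le hp hq
      | monomial n c =>
        rw [← C_mul_X_pow_eq_monomial, map_mul, map_mul, map_pow, map_pow]
        exact mul_le_one' (hK c) (pow_le_one' hx n)
    obtain ⟨v, hv⟩ := exists_eq_valuation (R := W.CoordinateRing) hw fun a =>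
      valuation_le_one_of_isIntegral w hpoly
        ((Algebra.IsIntegral.isIntegral a).algebraMap (B := W.FunctionField))
    obtain ⟨x, y, h, rfl⟩ := exists_eq_place v
    exact ⟨.some x y h, hv⟩
  · rw [not_le] at hx
    -- If w(y) ≤ w(x), the Weierstrass equation would bound w(x)³ by w(x)².
    have hxy : w (xFun W) < w (yFun W) := by
      by_contra! hle
      have h1 : w (xFun W ^ 3) ≤ w (xFun W) ^ 2 := by
        have h2 : xFun W ^ 3 = yFun W ^ 2 + algebraMap K W.FunctionField W.a₁ * xFun W * yFun W +
            algebraMap K W.FunctionField W.a₃ * yFun W -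
            (algebraMap K W.FunctionField W.a₂ * xFun W ^ 2 +
            algebraMap K W.FunctionField W.a₄ * xFun W + algebraMap K W.FunctionField W.a₆) := by
          rw [xFun_yFun_equation]; ring
        have hx2 : w (xFun W) ≤ w (xFun W) ^ 2 := le_self_pow hx.le two_ne_zero
        rw [h2]
        refine w.map_sub_le (w.map_add_le (w.map_add_le ?_ ?_) ?_)
          (w.map_add_le (w.map_add_le ?_ ?_) ?_)
        · rw [map_pow]; gcongr
        · rw [map_mul, map_mul, sq]
          exact mul_le_mul' (mul_le_of_le_one_left' (hK _)) hle
        · rw [map_mul]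
          exact (mul_le_of_le_one_left' (hK _)).trans (hle.trans hx2)
        · rw [map_mul, map_pow]
          exact mul_le_of_le_one_left' (hK _)
        · rw [map_mul]
          exact (mul_le_of_le_one_left' (hK _)).trans hx2
        · exact (hK _).trans (hx.le.trans hx2)
      rw [map_pow] at h1
      exact h1.not_gt (pow_lt_pow_right₀ hx (by norm_num))
    have hy := hx.trans hxy
    have hy0 : yFun W ≠ 0 := by intro h; simp [h] at hy
    have hwy : 0 < w (yFun W) := zero_lt_one.trans hy
    -- Homogeneous coordinates divided by y: they are integral for w and reduce to [0 : 1 : 0].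
    set u : Fin 3 → W.FunctionField := ![xFun W / yFun W, 1, 1 / yFun W] with hu
    have hui (i : Fin 3) : w (u i) ≤ 1 ∧
        w (u i - algebraMap K W.FunctionField ((![0, 1, 0] : Fin 3 → K) i)) < 1 := by
      fin_cases i
      · have : w (xFun W / yFun W) < 1 := by rwa [map_div₀, div_lt_one₀ hwy]
        refine ⟨this.le, ?_⟩
        simpa [hu] using this
      · simp [hu]
      · have : w (1 / yFun W) < 1 := by rwa [map_div₀, map_one, div_lt_one₀ hwy]
        refine ⟨this.le, ?_⟩
        simpa [hu] using this
    have hval (A : MvPolynomial (Fin 3) K) : w (MvPolynomial.aeval u A) ≤ 1 ∧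
        w (MvPolynomial.aeval u A - algebraMap K W.FunctionField
          (MvPolynomial.eval ![0, 1, 0] A)) < 1 := by
      induction A using MvPolynomial.induction_on with
      | C c => simpa using hK c
      | add p q hp hq =>
        simp only [map_add, add_sub_add_comm]
        exact ⟨w.map_add_le hp.1 hq.1, w.map_add_lt hp.2 hq.2⟩
      | mul_X p i hp =>
        simp only [map_mul, MvPolynomial.aeval_X, MvPolynomial.eval_X]
        refine ⟨mul_le_one' hp.1 (hui i).1, ?_⟩
        have : MvPolynomial.aeval u p * u i - algebraMap K W.FunctionField
            (MvPolynomial.eval ![0, 1, 0] p) *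
            algebraMap K W.FunctionField ((![0, 1, 0] : Fin 3 → K) i) =
            (MvPolynomial.aeval u p - algebraMap K W.FunctionField
              (MvPolynomial.eval ![0, 1, 0] p)) * u i +
            algebraMap K W.FunctionField (MvPolynomial.eval ![0, 1, 0] p) *
              (u i - algebraMap K W.FunctionField ((![0, 1, 0] : Fin 3 → K) i)) := by ring
        rw [this]
        refine w.map_add_lt ?_ ?_
        · rw [map_mul]; exact mul_lt_one_of_lt_of_le hp.2 (hui i).1
        · rw [map_mul, mul_comm]; exact mul_lt_one_of_lt_of_le (hui i).2 (hK _)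
    refine ⟨0, (valuation_eq_of_le (exists_val_eq_exp 0) hw fun g hg => ?_).symm⟩
    obtain ⟨n, A, B, hA, hB, hB0, h1⟩ := exists_forms_of_val_le_one hg
    have hxyu : (![xFun W, yFun W, 1] : Fin 3 → W.FunctionField) = fun i => yFun W * u i := by
      ext i
      fin_cases i
      · simp [hu, mul_div_cancel₀ _ hy0]
      · simp [hu]
      · simp [hu, hy0]
    rw [hxyu, aeval_mul_of_isHomogeneous hA, aeval_mul_of_isHomogeneous hB, mul_left_comm] at h1
    have h2 := congrArg w (mul_left_cancel₀ (pow_ne_zero n hy0) h1)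
    -- B(u) reduces to the nonzero constant B(0, 1, 0), and nonzero constants are units for w.
    have hB1 : w (MvPolynomial.aeval u B) = 1 := by
      refine (hval B).1.antisymm ?_
      by_contra! hlt
      have h3 := w.map_sub_lt hlt (hval B).2
      rw [sub_sub_cancel] at h3
      have h4 := mul_lt_one_of_lt_of_le h3 (hK (MvPolynomial.eval ![0, 1, 0] B)⁻¹)
      rw [← map_mul, ← map_mul, mul_inv_cancel₀ (by exact hB0)] at h4
      simp at h4
    rw [map_mul, hB1, mul_one] at h2
    rw [h2]
    exact (hval A).1

end Classification

end

end EllipticIsogeny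

namespace EllipticIsogeny

open WeierstrassCurve Polynomial IsDedekindDomain nonZeroDivisors WithZero

noncomputable section

/-! ### The extension of function fields and the integral closure -/

section TranscendenceDegree

variable {K : Type*} [Field K] {W : Affine K}

instance : Algebra.EssFiniteType K W.FunctionField :=
  have : Algebra.EssFiniteType W.CoordinateRing W.FunctionField :=
    Algebra.EssFiniteType.of_isLocalization _ W.CoordinateRing⁰
  Algebra.EssFiniteType.comp K W.CoordinateRing W.FunctionField

variable (W) in
lemma trdeg_functionField : Algebra.trdeg K W.FunctionField = 1 := by
  have h1 : Algebra.IsAlgebraic K[X] W.FunctionField := by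
    have : Algebra.IsAlgebraic K[X] W.CoordinateRing := Algebra.IsIntegral.isAlgebraic
    have : Algebra.IsAlgebraic W.CoordinateRing W.FunctionField :=
      IsLocalization.isAlgebraic _ W.CoordinateRing⁰
    exact Algebra.IsAlgebraic.trans K[X] W.CoordinateRing W.FunctionField
  have : FaithfulSMul K[X] W.FunctionField := FaithfulSMul.trans K[X] W.CoordinateRing _
  rw [← trdeg_add_eq K K[X] (A := W.FunctionField), Polynomial.trdeg_of_isDomain,
    trdeg_eq_zero, add_zero]

end TranscendenceDegree

namespace Isogeny

variable {K : Type*} [Field K] {W₁ W₂ : Affine K} (f : Isogeny W₁ W₂)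

/-- The function field of the source of an isogeny, as an extension of that of the target. -/
def Source (_ : Isogeny W₁ W₂) : Type _ := W₁.FunctionField

instance : Field f.Source := inferInstanceAs (Field W₁.FunctionField)

instance : Algebra K f.Source := inferInstanceAs (Algebra K W₁.FunctionField)

instance : Algebra W₂.FunctionField f.Source :=
  RingHom.toAlgebra (S := W₁.FunctionField) f.comap.toRingHom

instance : Algebra W₂.CoordinateRing f.Source := RingHom.toAlgebra (S := W₁.FunctionField)
  (f.comap.toRingHom.comp (algebraMap W₂.CoordinateRing W₂.FunctionField))

instance : IsScalarTower W₂.CoordinateRing W₂.FunctionField f.Source :=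
  IsScalarTower.of_algebraMap_eq fun _ => rfl

instance : IsScalarTower K W₂.FunctionField f.Source :=
  IsScalarTower.of_algebraMap_eq fun c => (f.comap.commutes c).symm

/-- Both fields have transcendence degree one over K, so the extension is algebraic; it is also
finitely generated. -/
instance : FiniteDimensional W₂.FunctionField f.Source := by
  have h0 : Algebra.EssFiniteType K f.Source :=
    inferInstanceAs (Algebra.EssFiniteType K W₁.FunctionField)
  have h1 : Algebra.EssFiniteType W₂.FunctionField f.Source :=
    Algebra.EssFiniteType.of_comp K W₂.FunctionField f.Source
  have h2 : Algebra.trdeg K f.Source = 1 := trdeg_functionField W₁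
  rw [← trdeg_add_eq K W₂.FunctionField (A := f.Source), trdeg_functionField] at h2
  have h3 : Algebra.IsAlgebraic W₂.FunctionField f.Source :=
    trdeg_eq_zero_iff.mp ((Cardinal.add_right_inj_of_lt_aleph0 Cardinal.one_lt_aleph0).mp
      ((add_comm _ _).trans (h2.trans (zero_add 1).symm)))
  exact Algebra.finite_of_essFiniteType_of_isAlgebraic

lemma finrank_source : Module.finrank W₂.FunctionField f.Source = f.degree :=
  Algebra.finrank_eq_of_equiv_equiv f.comap.equivFieldRange.toRingEquiv
    (RingEquiv.refl W₁.FunctionField) rfl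

/-- The integral closure of the coordinate ring of the target in the function field of the
source. -/
abbrev IntClosure : Type _ := integralClosure W₂.CoordinateRing f.Source

variable [CharZero K] [IsAlgClosed K] [W₂.IsElliptic]

instance : CharZero W₂.FunctionField := charZero_of_injective_algebraMap
  (algebraMap K W₂.FunctionField).injective

instance : IsDedekindDomain f.IntClosure :=
  IsIntegralClosure.isDedekindDomain W₂.CoordinateRing W₂.FunctionField f.Source _

instance : Module.Finite W₂.CoordinateRing f.IntClosure :=
  IsIntegralClosure.finite W₂.CoordinateRing W₂.FunctionField f.Source _

instance : IsFractionRing f.IntClosure f.Source :=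
  integralClosure.isFractionRing_of_finite_extension W₂.FunctionField f.Source

instance : FaithfulSMul W₂.CoordinateRing f.Source :=
  FaithfulSMul.trans W₂.CoordinateRing W₂.FunctionField f.Source

instance : FaithfulSMul W₂.CoordinateRing f.IntClosure :=
  FaithfulSMul.tower_bot W₂.CoordinateRing f.IntClosure f.Source

instance : Module.IsTorsionFree W₂.CoordinateRing f.IntClosure := inferInstance

end Isogeny

end

end EllipticIsogeny

namespace EllipticIsogeny

open WeierstrassCurve Polynomial IsDedekindDomain nonZeroDivisors WithZero

noncomputable section

/-! ### Primes of the integral closure, and additivity of isogenies -/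

section Points

variable {K : Type*} [Field K] {W : Affine K}

lemma isMaximal_pointMaximal {P : W.Point} (hP : P ≠ 0) : (pointMaximal P).IsMaximal := by
  cases P with
  | zero => exact (hP rfl).elim
  | some x y h => exact isMaximal_XYIdeal h.1

lemma pointMaximal_injective : Function.Injective (pointMaximal (W := W)) := by
  rintro (_ | ⟨x, y, h⟩) (_ | ⟨x', y', h'⟩) he
  · rfl
  · exact ((isMaximal_XYIdeal h'.1).ne_top he.symm).elim
  · exact ((isMaximal_XYIdeal h.1).ne_top he).elim
  · obtain ⟨rfl, rfl⟩ := XYIdeal_injective h.1 h'.1 he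
    rfl

variable [IsAlgClosed K] [W.IsElliptic]

lemma val_xFun_le_one_iff (P : W.Point) : val P (xFun W) ≤ 1 ↔ P ≠ 0 := by
  cases P with
  | zero =>
    refine iff_of_false ?_ (fun h => h rfl)
    change ¬ val 0 (xFun W) ≤ 1
    rw [val_xFun_zero, ← exp_zero, exp_le_exp]
    norm_num
  | some x y h => exact iff_of_true ((place h).valuation_le_one _) (Affine.Point.some_ne_zero h)

lemma val_algebraMap_le_one {P : W.Point} (hP : P ≠ 0) (a : W.CoordinateRing) :
    val P (algebraMap W.CoordinateRing W.FunctionField a) ≤ 1 := by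
  cases P with
  | zero => exact (hP rfl).elim
  | some x y h => exact (place h).valuation_le_one _

lemma val_algebraMap_lt_one_iff {P : W.Point} (hP : P ≠ 0) (a : W.CoordinateRing) :
    val P (algebraMap W.CoordinateRing W.FunctionField a) < 1 ↔ a ∈ pointMaximal P := by
  cases P with
  | zero => exact (hP rfl).elim
  | some x y h => exact (place h).valuation_lt_one_iff_mem a

/-- O is the only pole of x; affine points are recovered from their maximal ideals. -/
lemma val_injective : Function.Injective (val (W := W)) := by
  intro P Q h
  by_cases hP : P = 0
  · by_contra hQ
    exact (val_xFun_le_one_iff P).mp (h ▸ (val_xFun_le_one_iff Q).mpr (fun h0 => hQ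
      (hP.trans h0.symm))) hP
  · have hQ : Q ≠ 0 := (val_xFun_le_one_iff Q).mp (h ▸ (val_xFun_le_one_iff P).mpr hP)
    refine pointMaximal_injective (Ideal.ext fun a => ?_)
    rw [← val_algebraMap_lt_one_iff hP, ← val_algebraMap_lt_one_iff hQ, h]

/-- The residue field of an affine point is the base field. -/
def residueEquiv {P : W.Point} (hP : P ≠ 0) : (W.CoordinateRing ⧸ pointMaximal P) ≃+* K :=
  match P, hP with
  | .zero, hP => (hP rfl).elim
  | .some _ _ h, _ => (Affine.CoordinateRing.quotientXYIdealEquiv h.1).toRingEquiv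

end Points

namespace Isogeny

variable {K : Type*} [Field K] {W₁ W₂ : Affine K} (f : Isogeny W₁ W₂)
  [IsAlgClosed K] [W₁.IsElliptic]

/-- The valuation at a point of the source of an isogeny. -/
def sourceVal (P : W₁.Point) : Valuation f.Source ℤᵐ⁰ := val P

lemma sourceVal_injective : Function.Injective f.sourceVal := val_injective

lemma exists_sourceVal_eq_exp (P : W₁.Point) : ∃ t, f.sourceVal P t = exp (-1 : ℤ) :=
  exists_val_eq_exp P

variable [W₂.IsElliptic]

lemma val_comap_le_one {P : W₁.Point} {g : W₂.FunctionField} (h : val (f.toFun P) g ≤ 1) :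
    val P (f.comap g) ≤ 1 := by
  obtain ⟨c, hc⟩ := regularAt_iff.mpr h
  exact regularAt_iff.mp ⟨c, f.hasValueAt_comap P g c hc⟩

lemma val_comap_lt_one {P : W₁.Point} {g : W₂.FunctionField} (h : val (f.toFun P) g < 1) :
    val P (f.comap g) < 1 :=
  hasValueAt_zero_iff.mp (f.hasValueAt_comap P g 0 (hasValueAt_zero_iff.mpr h))

lemma sourceVal_algebraMap_le_one {P : W₁.Point} (hP : f.toFun P ≠ 0) (b : f.IntClosure) :
    f.sourceVal P (algebraMap f.IntClosure f.Source b) ≤ 1 :=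
  valuation_le_one_of_isIntegral (R := W₂.CoordinateRing) (f.sourceVal P)
    (fun a => f.val_comap_le_one (val_algebraMap_le_one hP a)) b.2

variable [CharZero K]

lemma exists_prime {P : W₁.Point} (hP : f.toFun P ≠ 0) :
    ∃ v : HeightOneSpectrum f.IntClosure, f.sourceVal P = v.valuation f.Source :=
  exists_eq_valuation (f.exists_sourceVal_eq_exp P) (f.sourceVal_algebraMap_le_one hP)

/-- The valuation of the prime comes from some point P of the source. If f(P) were O, then 1/x would
vanish at f(P) and f^*x would have a pole at P, although it lies in the integral closure. -/
lemma exists_point (v : HeightOneSpectrum f.IntClosure) :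
    ∃ P, f.toFun P ≠ 0 ∧ f.sourceVal P = v.valuation f.Source := by
  obtain ⟨P, hP⟩ := exists_eq_val (W := W₁) (w := v.valuation f.Source)
    (v.valuation_exists_uniformizer f.Source) fun c => by
      have h1 : algebraMap K W₁.FunctionField c = algebraMap f.IntClosure f.Source
        (algebraMap W₂.CoordinateRing f.IntClosure (algebraMap K W₂.CoordinateRing c)) :=
        (f.comap.commutes c).symm
      rw [h1]
      exact v.valuation_le_one (K := f.Source) _
  refine ⟨P, fun h0 => ?_, hP.symm⟩
  have h1 : val P (f.comap (xFun W₂)) ≤ 1 := by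
    rw [← hP]
    exact v.valuation_le_one (K := f.Source)
      (algebraMap W₂.CoordinateRing f.IntClosure (Affine.CoordinateRing.mk W₂ (C X)))
  have h2 : val P (f.comap (xFun W₂)⁻¹) < 1 := by
    refine f.val_comap_lt_one ?_
    rw [h0, map_inv₀, val_xFun_zero, ← exp_neg, ← exp_zero, exp_lt_exp]
    norm_num
  rw [map_inv₀, map_inv₀] at h2
  have hx : xFun W₂ ≠ 0 := fun h => by
    have := val_xFun_zero (W := W₂)
    rw [h, _root_.map_zero] at this
    exact exp_ne_zero this.symm
  rw [inv_lt_one₀ (zero_lt_iff.mpr ((Valuation.ne_zero_iff _).mpr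
    ((map_ne_zero_iff _ f.comap.injective).mpr hx)))] at h2
  exact h1.not_gt h2

/-- The prime of the integral closure attached to a point that is not in the kernel. -/
def primeAt {P : W₁.Point} (hP : f.toFun P ≠ 0) : HeightOneSpectrum f.IntClosure :=
  (f.exists_prime hP).choose

lemma valuation_primeAt {P : W₁.Point} (hP : f.toFun P ≠ 0) :
    (f.primeAt hP).valuation f.Source = f.sourceVal P := (f.exists_prime hP).choose_spec.symm

lemma primeAt_injective {P Q : W₁.Point} (hP : f.toFun P ≠ 0) (hQ : f.toFun Q ≠ 0)
    (h : f.primeAt hP = f.primeAt hQ) : P = Q :=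
  f.sourceVal_injective (by rw [← f.valuation_primeAt hP, ← f.valuation_primeAt hQ, h])

lemma exists_eq_primeAt (v : HeightOneSpectrum f.IntClosure) :
    ∃ P, ∃ hP : f.toFun P ≠ 0, v = f.primeAt hP := by
  obtain ⟨P, hP, h⟩ := f.exists_point v
  refine ⟨P, hP, HeightOneSpectrum.eq_of_valuation_isEquiv_valuation (K := f.Source) ?_⟩
  rw [f.valuation_primeAt hP, h]

lemma liesOver_primeAt {P : W₁.Point} (hP : f.toFun P ≠ 0) :
    (f.primeAt hP).asIdeal.LiesOver (pointMaximal (f.toFun P)) := by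
  refine ⟨(isMaximal_pointMaximal hP).eq_of_le (Ideal.comap_ne_top _ (f.primeAt hP).isPrime.ne_top)
    fun a ha => ?_⟩
  refine ((f.primeAt hP).valuation_lt_one_iff_mem (K := f.Source) _).mp ?_
  rw [f.valuation_primeAt hP]
  exact f.val_comap_lt_one ((val_algebraMap_lt_one_iff hP a).mpr ha)

lemma inertiaDeg_primeAt {P : W₁.Point} (hP : f.toFun P ≠ 0) :
    (f.primeAt hP).asIdeal.inertiaDeg W₂.CoordinateRing = 1 := by
  have := f.liesOver_primeAt hP
  have := isMaximal_pointMaximal hP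
  have := (f.primeAt hP).isMaximal
  exact inertiaDeg_eq_one (pointMaximal (f.toFun P)) _ (residueEquiv hP)

open Classical in
/-- The ideal of the integral closure attached to a point; the unit ideal on the kernel. -/
def sourceIdeal (P : W₁.Point) : Ideal f.IntClosure :=
  if hP : f.toFun P ≠ 0 then (f.primeAt hP).asIdeal else ⊤

lemma sourceIdeal_ne_zero (P : W₁.Point) : f.sourceIdeal P ≠ 0 := by
  rw [sourceIdeal]
  split_ifs with hP
  · exact (f.primeAt hP).ne_bot
  · exact top_ne_bot

instance : PerfectField (FractionRing W₂.CoordinateRing) :=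
  inferInstanceAs (PerfectField W₂.FunctionField)

/-- The norm of ideals realises f on points, since all inertia degrees are one. On the kernel the
unit ideal goes to the unit ideal, which is the convention for O. -/
lemma relNorm_sourceIdeal (P : W₁.Point) :
    Ideal.relNorm W₂.CoordinateRing (f.sourceIdeal P) = pointMaximal (f.toFun P) := by
  rw [sourceIdeal]
  split_ifs with hP
  · have := f.liesOver_primeAt hP
    have := isMaximal_pointMaximal hP
    have := (f.primeAt hP).isMaximal
    rw [Ideal.relNorm_eq_pow_of_isMaximal _ (pointMaximal (f.toFun P)), f.inertiaDeg_primeAt hP,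
      pow_one]
  · rw [Ideal.relNorm_top, not_not.mp hP]
    rfl

lemma count_sourceIdeal [DecidableEq W₁.Point] {P : W₁.Point} (hP : f.toFun P ≠ 0)
    (Q : W₁.Point) :
    FractionalIdeal.count f.Source (f.primeAt hP)
      (f.sourceIdeal Q : FractionalIdeal f.IntClosure⁰ f.Source) = if Q = P then 1 else 0 := by
  rw [sourceIdeal]
  split_ifs with hQ he he
  · subst he
    exact FractionalIdeal.count_self f.Source (f.primeAt hP)
  · exact FractionalIdeal.count_maximal_coprime f.Source (f.primeAt hP)
      fun h => he (f.primeAt_injective hQ hP h)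
  · exact (hQ (he ▸ hP)).elim
  · rw [FractionalIdeal.coeIdeal_top]
    exact FractionalIdeal.count_one f.Source (f.primeAt hP)

/-- Away from O, (P + Q) - (P) - (Q) is the divisor of a function, so the corresponding product of
ideals of the integral closure is principal. Its norm is a relation between the classes of f(P + Q),
f(P) and f(Q), and `toClass` is injective. -/
lemma map_add [DecidableEq K] (P Q : W₁.Point) : f.toFun (P + Q) = f.toFun P + f.toFun Q := by
  classical
  obtain ⟨g, hg, h⟩ := (sum_zsmul_eq_zero_iff (Finsupp.single (P + Q) 1 - Finsupp.single P 1 -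
    Finsupp.single Q 1 : Divisor W₁)).mp (by
      rw [Finsupp.sum_sub_index (by intros; rw [sub_smul]),
        Finsupp.sum_sub_index (by intros; rw [sub_smul])]
      simp)
  obtain ⟨b, c, hc, hbc⟩ := IsFractionRing.div_surjective (A := f.IntClosure) (K := f.Source) g
  have hc0 : algebraMap f.IntClosure f.Source c ≠ 0 := by
    simpa using nonZeroDivisors.ne_zero hc
  have hb0 : algebraMap f.IntClosure f.Source b ≠ 0 := by
    rintro h0
    rw [h0, zero_div] at hbc
    exact hg hbc.symm
  -- Denominators are cleared to keep the ideals integral, as the relative norm requires. Comparing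
  -- multiplicities involves only points outside the kernel, so O never occurs.
  have hideal : Ideal.span {b} * (f.sourceIdeal P * f.sourceIdeal Q) =
      Ideal.span {c} * f.sourceIdeal (P + Q) := by
    rw [← FractionalIdeal.coeIdeal_inj (K := f.Source)]
    simp only [FractionalIdeal.coeIdeal_mul, FractionalIdeal.coeIdeal_span_singleton]
    have hne (R : W₁.Point) :
        (f.sourceIdeal R : FractionalIdeal f.IntClosure⁰ f.Source) ≠ 0 :=
      FractionalIdeal.coeIdeal_ne_zero.mpr (f.sourceIdeal_ne_zero R)
    have hsb : FractionalIdeal.spanSingleton f.IntClosure⁰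
        (algebraMap f.IntClosure f.Source b) ≠ 0 :=
      FractionalIdeal.spanSingleton_ne_zero_iff.mpr hb0
    have hsc : FractionalIdeal.spanSingleton f.IntClosure⁰
        (algebraMap f.IntClosure f.Source c) ≠ 0 :=
      FractionalIdeal.spanSingleton_ne_zero_iff.mpr hc0
    refine fractionalIdeal_eq_of_count_eq (mul_ne_zero hsb (mul_ne_zero (hne P) (hne Q)))
      (mul_ne_zero hsc (hne _)) fun v => ?_
    obtain ⟨R, hR, rfl⟩ := f.exists_eq_primeAt v
    rw [FractionalIdeal.count_mul _ _ hsb (mul_ne_zero (hne P) (hne Q)),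
      FractionalIdeal.count_mul _ _ (hne P) (hne Q), FractionalIdeal.count_mul _ _ hsc (hne _),
      count_spanSingleton _ hb0, count_spanSingleton _ hc0, f.valuation_primeAt hR,
      f.count_sourceIdeal hR, f.count_sourceIdeal hR, f.count_sourceIdeal hR]
    have hR0 : R ≠ 0 := fun h0 => hR (h0 ▸ f.map_zero)
    have h1 := h R hR0
    rw [ord_eq R hg] at h1
    have h2 : log (f.sourceVal R (algebraMap f.IntClosure f.Source b)) =
        log (val R g) + log (f.sourceVal R (algebraMap f.IntClosure f.Source c)) := by
      rw [(div_eq_iff hc0).mp hbc]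
      refine (congrArg log ((f.sourceVal R).map_mul _ _)).trans (log_mul ?_ ?_)
      · exact (Valuation.ne_zero_iff (val R)).mpr hg
      · exact (Valuation.ne_zero_iff _).mpr hc0
    simp only [Finsupp.sub_apply, Finsupp.single_apply] at h1
    rw [h2]
    lia
  have hnorm := congrArg (Ideal.relNorm W₂.CoordinateRing) hideal
  simp only [_root_.map_mul, Ideal.relNorm_singleton, f.relNorm_sourceIdeal] at hnorm
  refine Affine.Point.toClass_injective ?_
  rw [_root_.map_add, toClass_eq, toClass_eq, toClass_eq, ← ofMul_mul, ← _root_.map_mul]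
  congr 1
  symm
  refine (ClassGroup.mk_eq_mk_of_coe_ideal (I' := pointMaximal (f.toFun P) *
    pointMaximal (f.toFun Q)) (J' := pointMaximal (f.toFun (P + Q))) ?_ ?_).mpr
    ⟨_, _, ?_, ?_, hnorm⟩
  · rw [FractionalIdeal.coeIdeal_mul, coe_pointMaximal, coe_pointMaximal]
    rfl
  · exact (coe_pointMaximal _).symm
  · exact Algebra.intNorm_ne_zero.mpr (by rintro rfl; simp at hb0)
  · exact Algebra.intNorm_ne_zero.mpr (by rintro rfl; simp at hc0)

end Isogeny

end

end EllipticIsogeny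

namespace EllipticIsogeny

open WeierstrassCurve Polynomial IsDedekindDomain nonZeroDivisors WithZero

noncomputable section

/-! ### Fibres, ramification and the kernel -/

lemma infinite_point {K : Type*} [Field K] [IsAlgClosed K] (W : Affine K) [W.IsElliptic] :
    Infinite W.Point := by
  have hex (x : K) : ∃ P : W.Point, ∃ y h, P = .some x y h := by
    obtain ⟨y, hy⟩ := IsAlgClosed.exists_root (W.polynomial.map (evalRingHom x)) (by
      rw [Affine.monic_polynomial.degree_map, Affine.degree_polynomial]
      norm_num)
    have heq : W.Equation x y := by
      rwa [Affine.Equation, ← map_evalRingHom_eval]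
    exact ⟨_, y, (Affine.equation_iff_nonsingular).mp heq, rfl⟩
  choose p hp using hex
  refine Infinite.of_injective p fun x x' h => ?_
  obtain ⟨y, hy, e⟩ := hp x
  obtain ⟨y', hy', e'⟩ := hp x'
  rw [e, e'] at h
  exact (Affine.Point.some.inj h).1

lemma pointMaximal_ne_bot {K : Type*} [Field K] {W : Affine K} (P : W.Point) :
    pointMaximal P ≠ ⊥ := by
  cases P with
  | zero => exact top_ne_bot
  | some x y h => exact (place h).ne_bot

namespace Isogeny

variable {K : Type*} [Field K] {W₁ W₂ : Affine K} (f : Isogeny W₁ W₂)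

lemma degree_pos : 0 < f.degree := by
  rw [← f.finrank_source]
  exact Module.finrank_pos

lemma pullback_single (Q : W₂.Point) :
    f.pullback (Finsupp.single Q 1) =
      ∑ P ∈ (f.finite_fiber Q).toFinset, Finsupp.single P (f.ramificationIndex P) := by
  classical
  ext P
  rw [Finsupp.finsetSum_apply]
  simp only [Finsupp.single_apply]
  rw [Finset.sum_ite_eq']
  simp only [pullback, Finsupp.ofSupportFinite_coe, Finsupp.single_apply, Set.Finite.mem_toFinset,
    Set.mem_ofPred_eq, mul_ite, mul_one, mul_zero, eq_comm]

lemma sum_pullback_single (Q : W₂.Point) :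
    ((f.pullback (Finsupp.single Q 1)).sum fun _ n => n) =
      ∑ P ∈ (f.finite_fiber Q).toFinset, f.ramificationIndex P := by
  rw [f.pullback_single, ← Finsupp.sum_finsetSum_index (fun _ => rfl) (fun _ _ _ => rfl)]
  exact Finset.sum_congr rfl fun P _ => Finsupp.sum_single_index rfl

lemma pullback_apply (D : Divisor W₂) (P : W₁.Point) :
    f.pullback D P = f.ramificationIndex P * D (f.toFun P) := rfl

variable [IsAlgClosed K] [W₁.IsElliptic] [W₂.IsElliptic]

lemma val_comap_eq_one {P : W₁.Point} {g : W₂.FunctionField} (h : val (f.toFun P) g = 1) :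
    val P (f.comap g) = 1 := by
  refine le_antisymm (f.val_comap_le_one h.le) ?_
  have h1 := f.val_comap_le_one (P := P) (g := g⁻¹) (by rw [map_inv₀, h, inv_one])
  have hg : g ≠ 0 := by
    rintro rfl
    simp at h
  rw [map_inv₀, map_inv₀, inv_le_one₀ (zero_lt_iff.mpr ((Valuation.ne_zero_iff _).mpr
    ((map_ne_zero_iff _ f.comap.injective).mpr hg)))] at h1
  exact h1

/-- Dividing g by the appropriate power of a uniformizer leaves a unit at f(P), which pulls back to
a unit at P. -/
lemma ord_comap (P : W₁.Point) {g : W₂.FunctionField} (hg : g ≠ 0) :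
    ord P (f.comap g) = f.ramificationIndex P * ord (f.toFun P) g := by
  have ht : val (f.toFun P) (Classical.epsilon (IsUniformizer (f.toFun P))) = exp (-1 : ℤ) :=
    isUniformizer_iff.mp (Classical.epsilon_spec (exists_isUniformizer (f.toFun P)))
  rw [ramificationIndex]
  generalize Classical.epsilon (IsUniformizer (f.toFun P)) = t at ht
  have ht0 : t ≠ 0 := by
    rintro rfl
    rw [_root_.map_zero] at ht
    exact exp_ne_zero ht.symm
  have hc {u : W₂.FunctionField} (hu : u ≠ 0) : f.comap u ≠ 0 :=
    (map_ne_zero_iff _ f.comap.injective).mpr hu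
  have h1 : val P (f.comap (g * t ^ (-ord (f.toFun P) g))) = 1 := by
    refine f.val_comap_eq_one ?_
    rw [_root_.map_mul, map_zpow₀, ht, val_eq_exp_neg_ord _ hg, ← exp_zsmul, ← exp_add, ← exp_zero]
    congr 1
    simp
  rw [_root_.map_mul, map_zpow₀, _root_.map_mul, map_zpow₀] at h1
  have h2 := congrArg log h1
  rw [log_mul ((Valuation.ne_zero_iff _).mpr (hc hg))
    (zpow_ne_zero _ ((Valuation.ne_zero_iff _).mpr (hc ht0))), log_zpow, log_one] at h2
  rw [ord_eq P (hc hg), ord_eq P (hc ht0)]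
  rw [smul_eq_mul] at h2
  linarith

lemma ramificationIndex_pos (P : W₁.Point) : 0 < f.ramificationIndex P := by
  have ht := Classical.epsilon_spec (exists_isUniformizer (f.toFun P))
  have h0 := (map_ne_zero_iff _ f.comap.injective).mpr ht.1
  exact (ord_pos_iff h0).mpr (f.hasValueAt_comap P _ 0 ht.2.1)

variable [CharZero K]

attribute [local instance] FractionRing.liftAlgebra FractionRing.isScalarTower_liftAlgebra

/-- No point over the affine point `Q` ramifies. -/
def UnramifiedOver (Q : W₂.Point) : Prop :=
  Q ≠ 0 ∧ ∀ (P : W₁.Point) (hP : f.toFun P ≠ 0), f.toFun P = Q →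
    ¬ (f.primeAt hP).asIdeal ∣ differentIdeal W₂.CoordinateRing f.IntClosure

/-- The extension is separable, so the different is nonzero and has finitely many prime factors. -/
lemma finite_not_unramifiedOver : {Q | ¬ f.UnramifiedOver Q}.Finite := by
  have hfin := Ideal.finite_factors
    (differentIdeal_ne_bot (A := W₂.CoordinateRing) (B := f.IntClosure))
  choose pt hpt hpt' using f.exists_eq_primeAt
  refine ((Set.finite_singleton 0).union (hfin.image fun v => f.toFun (pt v))).subset ?_
  intro Q hQ
  by_cases hQ0 : Q = 0
  · exact .inl hQ0
  · simp only [UnramifiedOver, Set.mem_ofPred_eq, not_and, not_forall, not_not] at hQ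
    obtain ⟨P, hP, rfl, h⟩ := hQ hQ0
    exact .inr ⟨f.primeAt hP, h, congrArg f.toFun (f.primeAt_injective (hpt _) hP
      (hpt' _).symm)⟩

lemma ramificationIndex_eq_one {P : W₁.Point} (h : f.UnramifiedOver (f.toFun P)) :
    f.ramificationIndex P = 1 := by
  have hP := h.1
  refine le_antisymm (not_lt.mp fun hlt => h.2 P hP rfl ?_) (f.ramificationIndex_pos P)
  have := isMaximal_pointMaximal hP
  -- If the index were at least 2, the square of the prime at P would divide the extension of the
  -- ideal of f(P), and then the prime itself would divide the different.
  have := pow_sub_one_dvd_differentIdeal W₂.CoordinateRing (f.primeAt hP).asIdeal 2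
    (pointMaximal_ne_bot _) (by
    rw [Ideal.dvd_iff_le, Ideal.map_le_iff_le_comap]
    intro a ha
    rw [Ideal.mem_comap, ← HeightOneSpectrum.intValuation_le_pow_iff_mem,
      ← HeightOneSpectrum.valuation_of_algebraMap (K := f.Source), f.valuation_primeAt hP]
    change val P (f.comap (algebraMap W₂.CoordinateRing W₂.FunctionField a)) ≤ _
    by_cases ha0 : algebraMap W₂.CoordinateRing W₂.FunctionField a = 0
    · rw [ha0, _root_.map_zero, _root_.map_zero]
      exact zero_le
    have h1 := (val_algebraMap_lt_one_iff hP a).mpr ha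
    rw [← hasValueAt_zero_iff, ← ord_pos_iff ha0] at h1
    have hc := (map_ne_zero_iff f.comap f.comap.injective).mpr ha0
    rw [val_eq_exp_neg_ord P hc, f.ord_comap P ha0,
      exp_le_exp]
    push_cast
    nlinarith)
  rwa [pow_one] at this

/-- The points of the fibre are the primes over Q. In the formula Σ e f = d for these primes every e
and every f is one. -/
lemma card_fiber {Q : W₂.Point} (h : f.UnramifiedOver Q) :
    {P | f.toFun P = Q}.ncard = f.degree := by
  classical
  have := isMaximal_pointMaximal h.1
  have : Module.Flat W₂.CoordinateRing f.IntClosure := inferInstance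
  have : Fintype ((pointMaximal Q).primesOver f.IntClosure) :=
    (Algebra.QuasiFinite.finite_primesOver _).fintype
  rw [← f.finrank_source, IsFractionRing.finrank_eq W₂.CoordinateRing W₂.FunctionField
    f.IntClosure f.Source, ← Ideal.sum_ramification_inertia_eq_finrank (pointMaximal Q)]
  have hne {P : W₁.Point} (hP : f.toFun P = Q) : f.toFun P ≠ 0 := hP ▸ h.1
  let φ : {P | f.toFun P = Q} → (pointMaximal Q).primesOver f.IntClosure := fun P =>
    ⟨(f.primeAt (hne P.2)).asIdeal, (f.primeAt _).isPrime, by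
      have h1 := f.liesOver_primeAt (hne P.2)
      rwa [show f.toFun P = Q from P.2] at h1⟩
  have hφ : Function.Bijective φ := by
    refine ⟨fun P P' he => ?_, fun ⟨I, hI, hI'⟩ => ?_⟩
    · exact Subtype.ext (f.primeAt_injective _ _ (HeightOneSpectrum.ext (congrArg Subtype.val he)))
    · have hI0 : I ≠ ⊥ := Ideal.ne_bot_of_liesOver_of_ne_bot (pointMaximal_ne_bot Q) I
      obtain ⟨P, hP, hv⟩ := f.exists_eq_primeAt ⟨I, hI, hI0⟩
      have hv : I = (f.primeAt hP).asIdeal := congrArg HeightOneSpectrum.asIdeal hv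
      have hPQ : f.toFun P = Q := by
        refine pointMaximal_injective ?_
        rw [(f.liesOver_primeAt hP).over, hI'.over, hv]
      exact ⟨⟨P, hPQ⟩, Subtype.ext hv.symm⟩
  rw [← Nat.card_coe_set_eq, Nat.card_congr (Equiv.ofBijective φ hφ), Nat.card_eq_fintype_card,
    ← Finset.card_univ, Finset.card_eq_sum_ones]
  refine Finset.sum_congr rfl fun I _ => ?_
  obtain ⟨⟨P, hP⟩, rfl⟩ := hφ.2 I
  have := not_dvd_differentIdeal_iff.mp (h.2 P (hne hP) hP)
  exact (mul_eq_one.mpr ⟨Ideal.ramificationIdx_eq_one _ _, f.inertiaDeg_primeAt (hne hP)⟩).symm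

/-- Only finitely many points are excluded, and there are infinitely many. Both Q and -Q are needed
for `sum_fiber_add_sum_fiber`. -/
lemma exists_unramifiedOver : ∃ Q, f.UnramifiedOver Q ∧ f.UnramifiedOver (-Q) := by
  have := infinite_point W₂
  have hfin := f.finite_not_unramifiedOver
  obtain ⟨Q, hQ⟩ := (hfin.union (hfin.preimage neg_injective.injOn)).exists_notMem
  simp only [Set.mem_union, Set.mem_preimage, Set.mem_ofPred_eq, not_or, not_not] at hQ
  exact ⟨Q, hQ⟩

lemma sum_pullback {g : W₂.FunctionField} (hg : g ≠ 0) :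
    ((f.pullback (divisor hg)).sum fun _ n => n) = 0 := by
  have hg' := (map_ne_zero_iff _ f.comap.injective).mpr hg
  have : f.pullback (divisor hg) = divisor hg' := by
    ext P
    exact (f.ord_comap P hg).symm
  rw [this, sum_divisor]

lemma sum_fiber_of_unramifiedOver {Q : W₂.Point} (h : f.UnramifiedOver Q) :
    ∑ P ∈ (f.finite_fiber Q).toFinset, f.ramificationIndex P = f.degree := by
  rw [← f.card_fiber h, Set.ncard_eq_toFinset_card _ (f.finite_fiber Q), Finset.card_eq_sum_ones,
    Nat.cast_sum]
  refine Finset.sum_congr rfl fun P hP => ?_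
  have hP : f.toFun P = Q := by simpa using hP
  rw [f.ramificationIndex_eq_one (hP ▸ h), Nat.cast_one]

variable [DecidableEq K]

lemma map_neg (P : W₁.Point) : f.toFun (-P) = -f.toFun P := by
  rw [eq_neg_iff_add_eq_zero, ← f.map_add, neg_add_cancel, f.map_zero]

/-- By additivity the kernel is a translate of any nonempty fibre, in particular of an unramified
one. -/
lemma ncard_ker : f.ker.ncard = f.degree := by
  obtain ⟨Q, hQ, -⟩ := f.exists_unramifiedOver
  have hQ' := f.card_fiber hQ
  obtain ⟨P₀, hP₀⟩ := Set.nonempty_of_ncard_ne_zero (hQ'.trans_ne f.degree_pos.ne')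
  rw [← hQ', ← Set.ncard_image_of_injective f.ker (add_right_injective P₀)]
  congr 1
  ext P
  constructor
  · rintro ⟨R, hR, rfl⟩
    change f.toFun (P₀ + R) = Q
    rw [f.map_add, show f.toFun R = 0 from hR, add_zero]
    exact hP₀
  · intro hP
    refine ⟨-P₀ + P, ?_, add_neg_cancel_left _ _⟩
    change f.toFun (-P₀ + P) = 0
    rw [f.map_add, f.map_neg, show f.toFun P₀ = Q from hP₀, show f.toFun P = Q from hP,
      neg_add_cancel]

/-- (Q) + (-Q) - 2(O) is principal, hence so is its pullback, which therefore has degree zero. This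
reaches the fibre over O from affine fibres. -/
lemma sum_fiber_add_sum_fiber (Q : W₂.Point) :
    ∑ P ∈ (f.finite_fiber Q).toFinset, f.ramificationIndex P +
      ∑ P ∈ (f.finite_fiber (-Q)).toFinset, f.ramificationIndex P =
    2 * ∑ P ∈ (f.finite_fiber 0).toFinset, f.ramificationIndex P := by
  obtain ⟨g, hg⟩ := (exists_isDivisorOf_iff (Finsupp.single Q 1 + Finsupp.single (-Q) 1 -
    (Finsupp.single 0 1 + Finsupp.single 0 1) : Divisor W₂)).mpr (by
      constructor
      · rw [Finsupp.sum_sub_index (by intros; rfl), Finsupp.sum_add_index' (by simp) (by simp),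
          Finsupp.sum_add_index' (by simp) (by simp)]
        simp
      · rw [Finsupp.sum_sub_index (by intros; rw [sub_smul]),
          Finsupp.sum_add_index' (by simp) (by intros; rw [add_smul]),
          Finsupp.sum_add_index' (by simp) (by intros; rw [add_smul])]
        simp)
  have h := f.sum_pullback hg.1
  rw [(isDivisorOf_iff hg.1 _).mp hg] at h
  have hD : f.pullback (Finsupp.single Q 1 + Finsupp.single (-Q) 1 -
      (Finsupp.single 0 1 + Finsupp.single 0 1)) = f.pullback (Finsupp.single Q 1) +
      f.pullback (Finsupp.single (-Q) 1) - (f.pullback (Finsupp.single 0 1) +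
        f.pullback (Finsupp.single 0 1)) := by
    ext P
    simp only [pullback_apply, Finsupp.add_apply, Finsupp.sub_apply]
    ring
  rw [hD, Finsupp.sum_sub_index (by intros; rfl),
    Finsupp.sum_add_index' (fun _ => rfl) (fun _ _ _ => rfl),
    Finsupp.sum_add_index' (fun _ => rfl) (fun _ _ _ => rfl), f.sum_pullback_single,
    f.sum_pullback_single, f.sum_pullback_single] at h
  linarith

/-- With Q and -Q unramified, the indices over O add up to d. The kernel has d points and every
index is at least one. -/
lemma ramificationIndex_of_mem_ker {P : W₁.Point} (hP : P ∈ f.ker) :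
    f.ramificationIndex P = 1 := by
  obtain ⟨Q, hQ, hQ'⟩ := f.exists_unramifiedOver
  have h1 := f.sum_fiber_add_sum_fiber Q
  rw [f.sum_fiber_of_unramifiedOver hQ, f.sum_fiber_of_unramifiedOver hQ'] at h1
  have h2 : ∑ P ∈ (f.finite_fiber 0).toFinset, (1 : ℤ) = f.degree := by
    rw [← f.ncard_ker, Set.ncard_eq_toFinset_card f.ker (f.finite_fiber 0), Finset.sum_const,
      nsmul_one]
    rfl
  have h3 : ∑ P ∈ (f.finite_fiber 0).toFinset, (1 : ℤ) =
      ∑ P ∈ (f.finite_fiber 0).toFinset, f.ramificationIndex P := by linarith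
  exact ((Finset.sum_eq_sum_iff_of_le fun P _ => f.ramificationIndex_pos P).mp h3 P
    ((f.finite_fiber 0).mem_toFinset.mpr hP)).symm

/-- The pullback of the origin is the sum of the points of the kernel. -/
lemma pullback_single_zero : f.pullback (Finsupp.single 0 1) =
    ∑ P ∈ (f.finite_fiber 0).toFinset, Finsupp.single P 1 := by
  rw [f.pullback_single]
  refine Finset.sum_congr rfl fun P hP => ?_
  rw [f.ramificationIndex_of_mem_ker ((f.finite_fiber 0).mem_toFinset.mp hP)]

/-- Abel's theorem: the degrees agree since the kernel has d points, so only the sum in the group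
matters. -/
lemma linEquiv_pullback_iff :
    LinEquiv (f.pullback (Finsupp.single 0 1)) (f.degree • Finsupp.single 0 1) ↔
      ∑ P ∈ (f.finite_fiber 0).toFinset, P = 0 := by
  have h1 : ((f.pullback (Finsupp.single 0 1)).sum fun _ n => n) = f.degree := by
    rw [f.sum_pullback_single, ← f.ncard_ker,
      Set.ncard_eq_toFinset_card f.ker (f.finite_fiber 0), Finset.card_eq_sum_ones, Nat.cast_sum]
    exact Finset.sum_congr rfl fun P hP =>
      f.ramificationIndex_of_mem_ker ((f.finite_fiber 0).mem_toFinset.mp hP)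
  have h2 : ((f.pullback (Finsupp.single 0 1)).sum fun P n => n • P) =
      ∑ P ∈ (f.finite_fiber 0).toFinset, P := by
    rw [f.pullback_single_zero, ← Finsupp.sum_finsetSum_index (by simp)
      (by intros; rw [add_smul])]
    refine Finset.sum_congr rfl fun P _ => ?_
    rw [Finsupp.sum_single_index (by simp), one_smul]
  rw [LinEquiv, exists_isDivisorOf_iff, Finsupp.sum_sub_index (by intros; rfl),
    Finsupp.sum_sub_index (by intros; rw [sub_smul]), h1, h2, Finsupp.smul_single,
    Finsupp.sum_single_index rfl, Finsupp.sum_single_index (by simp)]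
  simp

end Isogeny

end

end EllipticIsogeny

namespace EllipticIsogeny

open WeierstrassCurve Polynomial IsDedekindDomain nonZeroDivisors WithZero

noncomputable section

/-! ### The sum of the elements of a finite abelian group -/

section FiniteGroup

variable {A : Type*} [AddCommGroup A] [Fintype A]

/-- In a finite group of exponent two, pair each element with its translate by `a`. -/
lemma sum_univ_eq_nsmul (h2 : ∀ a : A, 2 • a = 0) {a : A} (ha : a ≠ 0) :
    ∑ x : A, x = (Fintype.card A / 2) • a := by
  classical
  have hcard : Fintype.card (AddSubgroup.zmultiples a) = 2 := by
    rw [Fintype.card_zmultiples]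
    exact addOrderOf_eq_prime (h2 a) ha
  have hsum : ∑ h : AddSubgroup.zmultiples a, (h : A) = a := by
    have huniv : (Finset.univ : Finset (AddSubgroup.zmultiples a)) =
        {0, ⟨a, AddSubgroup.mem_zmultiples a⟩} := by
      refine (Finset.eq_of_subset_of_card_le (Finset.subset_univ _) ?_).symm
      rw [Finset.card_univ, hcard, Finset.card_pair]
      exact fun h => ha (congrArg Subtype.val h).symm
    rw [huniv, Finset.sum_pair fun h => ha (congrArg Subtype.val h).symm]
    exact zero_add a
  have hmk (q : A ⧸ AddSubgroup.zmultiples a) (h : AddSubgroup.zmultiples a) :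
      ((q.out + h : A) : A ⧸ AddSubgroup.zmultiples a) = q := by
    rw [QuotientAddGroup.mk_add_of_mem _ h.2, QuotientAddGroup.out_eq']
  let φ : (A ⧸ AddSubgroup.zmultiples a) × AddSubgroup.zmultiples a → A := fun p => p.1.out + p.2
  have hφ : Function.Bijective φ := by
    refine ⟨fun ⟨q, h⟩ ⟨q', h'⟩ he => ?_, fun x => ?_⟩
    · obtain rfl : q = q' := by
        rw [← hmk q h, ← hmk q' h']
        exact congrArg _ he
      exact Prod.ext rfl (Subtype.ext (add_left_cancel (show q.out + (h : A) = q.out + h' from he)))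
    · obtain ⟨h, hh⟩ := QuotientAddGroup.mk_out_eq_add (AddSubgroup.zmultiples a) x
      refine ⟨(x, -h), ?_⟩
      change Quotient.out (x : A ⧸ AddSubgroup.zmultiples a) + ((-h : _) : A) = x
      rw [hh]
      simp
  have hquot : Fintype.card A / 2 = Fintype.card (A ⧸ AddSubgroup.zmultiples a) := by
    rw [← Fintype.card_of_bijective hφ, Fintype.card_prod, hcard, Nat.mul_div_cancel _ two_pos]
  rw [hquot, ← hφ.sum_comp, Fintype.sum_prod_type]
  have h1 (q : A ⧸ AddSubgroup.zmultiples a) :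
      ∑ h : AddSubgroup.zmultiples a, φ (q, h) = a := by
    change ∑ h : AddSubgroup.zmultiples a, (q.out + (h : A)) = a
    rw [Finset.sum_add_distrib, hsum, Finset.sum_const, Finset.card_univ, hcard, h2, zero_add]
  simp only [h1]
  rw [Finset.sum_const, Finset.card_univ]

lemma sum_univ_eq_zero_iff_of_two_nsmul (h2 : ∀ a : A, 2 • a = 0) :
    ∑ x : A, x = 0 ↔ Fintype.card A ≠ 2 := by
  classical
  constructor
  · intro h hc
    obtain ⟨a, ha⟩ := Fintype.exists_ne_of_one_lt_card (by omega : 1 < Fintype.card A) 0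
    rw [sum_univ_eq_nsmul h2 ha, hc, Nat.div_self two_pos, one_nsmul] at h
    exact ha h
  · intro hc
    by_cases h1 : ∀ a : A, a = 0
    · exact Finset.sum_eq_zero fun a _ => h1 a
    push Not at h1
    obtain ⟨a, ha⟩ := h1
    obtain ⟨b, hb⟩ : ∃ b, b ∉ ({0, a} : Finset A) := by
      by_contra! h
      apply hc
      rw [← Finset.card_univ, ← Finset.card_pair ha.symm]
      exact congrArg _ (Finset.eq_univ_of_forall h).symm
    simp only [Finset.mem_insert, Finset.mem_singleton, not_or] at hb
    have hab : a + b ≠ 0 := fun h => hb.2 (by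
      have h3 := h2 a
      rw [two_nsmul] at h3
      exact add_left_cancel (h.trans h3.symm))
    -- With m half the order of the group, the sum is m a, m (a + b) and m b at once. The first two
    -- give m b = 0, so the sum is zero.
    have e := (sum_univ_eq_nsmul h2 ha).symm.trans (sum_univ_eq_nsmul h2 hab)
    rw [nsmul_add, left_eq_add] at e
    rw [sum_univ_eq_nsmul h2 hb.1, e]

/-- The sum of the elements of a finite abelian group vanishes unless there is exactly one
element of order two. -/
lemma sum_univ_eq_zero_iff : ∑ x : A, x = 0 ↔ {x : A | 2 • x = 0}.ncard ≠ 2 := by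
  classical
  let T : AddSubgroup A := (nsmulAddMonoidHom 2 : A →+ A).ker
  have hT : ∑ x : A, x = ((∑ x : T, x : T) : A) := by
    rw [← Finset.sum_filter_add_sum_filter_not Finset.univ (fun x : A => x ∈ T)]
    -- Outside the 2-torsion x ≠ -x, and the two cancel.
    have h1 : ∑ x : A with x ∉ T, x = 0 := by
      refine Finset.sum_involution (fun x _ => -x) (fun x _ => add_neg_cancel x) ?_ ?_
        (fun x _ => neg_neg x)
      · intro x hx _ he
        refine (Finset.mem_filter.mp hx).2 ?_
        change 2 • x = 0
        rw [two_nsmul]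
        nth_rewrite 1 [← he]
        exact neg_add_cancel x
      · intro x hx
        simpa using hx
    rw [h1, add_zero, AddSubgroup.val_finsetSum, Finset.sum_subtype _ (p := (· ∈ T)) (by simp)]
  have hcard : {x : A | 2 • x = 0}.ncard = Fintype.card T := by
    rw [← Nat.card_coe_set_eq, ← Nat.card_eq_fintype_card]
    rfl
  rw [hT, hcard, ZeroMemClass.coe_eq_zero]
  exact sum_univ_eq_zero_iff_of_two_nsmul fun a => Subtype.ext a.2

end FiniteGroup

namespace Isogeny

variable {K : Type*} [Field K] {W₁ W₂ : Affine K} (f : Isogeny W₁ W₂)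
  [IsAlgClosed K] [W₁.IsElliptic] [W₂.IsElliptic] [CharZero K] [DecidableEq K]

lemma ncard_two_torsion_ne_two_iff :
    ({P | 2 • P = 0} ∩ f.ker).ncard ≠ 2 ↔ ∑ P ∈ (f.finite_fiber 0).toFinset, P = 0 := by
  let N : AddSubgroup W₁.Point :=
    { carrier := f.ker
      zero_mem' := f.map_zero
      add_mem' := fun {P Q} hP hQ => by
        change f.toFun (P + Q) = 0
        rw [f.map_add, show f.toFun P = 0 from hP, show f.toFun Q = 0 from hQ, add_zero]
      neg_mem' := fun {P} hP => by
        change f.toFun (-P) = 0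
        rw [f.map_neg, show f.toFun P = 0 from hP, neg_zero] }
  have : Fintype N := (f.finite_fiber 0).fintype
  have h1 : ∑ P ∈ (f.finite_fiber 0).toFinset, P = ((∑ P : N, P : N) : W₁.Point) := by
    rw [AddSubgroup.val_finsetSum]
    exact Finset.sum_subtype _ (p := (· ∈ N)) (fun P => (f.finite_fiber 0).mem_toFinset) _
  have h2 : ({P | 2 • P = 0} ∩ f.ker).ncard = {P : N | 2 • P = 0}.ncard := by
    rw [← Set.ncard_image_of_injective _ (Subtype.val_injective (p := (· ∈ N)))]
    congr 1
    ext P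
    constructor
    · rintro ⟨hP, hk⟩
      exact ⟨⟨P, hk⟩, Subtype.ext hP, rfl⟩
    · rintro ⟨Q, hQ, rfl⟩
      exact ⟨congrArg Subtype.val hQ, Q.2⟩
  rw [h1, h2, ZeroMemClass.coe_eq_zero]
  exact sum_univ_eq_zero_iff.symm

end Isogeny

end

end EllipticIsogeny

namespace EllipticIsogeny

open WeierstrassCurve Polynomial IsDedekindDomain nonZeroDivisors WithZero

noncomputable section

/-! ### Descent to k by linear functionals on coefficients -/

section CoefficientFunctional

variable {k K : Type*} [Field k] [Field K]

lemma coeff_sum_monomial (l : K →+ k) (p : K[X]) (n : ℕ) :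
    (∑ i ∈ p.support, monomial i (l (p.coeff i))).coeff n = l (p.coeff n) := by
  rw [finsetSum_coeff]
  simp only [coeff_monomial]
  rw [Finset.sum_ite_eq']
  split_ifs with hn
  · rfl
  · rw [notMem_support_iff.mp hn, map_zero]

/-- Apply an additive map to the coefficients of a polynomial. -/
def coeffMap (l : K →+ k) : K[X] →+ k[X] where
  toFun p := ∑ i ∈ p.support, monomial i (l (p.coeff i))
  map_zero' := by simp
  map_add' p q := by
    ext n
    rw [coeff_add, coeff_sum_monomial, coeff_sum_monomial, coeff_sum_monomial, coeff_add, map_add]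

lemma coeff_coeffMap (l : K →+ k) (p : K[X]) (n : ℕ) :
    (coeffMap l p).coeff n = l (p.coeff n) := coeff_sum_monomial l p n

variable [Algebra k K] (E : WeierstrassCurve k)

variable (K) in
/-- The inclusion of coordinate rings under base change. -/
abbrev coordinateRingMap :
    E.toAffine.CoordinateRing →+* (E.baseChange K).toAffine.CoordinateRing :=
  Affine.CoordinateRing.map E.toAffine (algebraMap k K)

lemma functionFieldMap_algebraMap (a : E.toAffine.CoordinateRing) :
    functionFieldMap K E (algebraMap _ _ a) = algebraMap _ _ (coordinateRingMap K E a) :=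
  IsLocalization.map_eq (M := E.toAffine.CoordinateRing⁰)
    (T := (E.baseChange K).toAffine.CoordinateRing⁰) (S := E.toAffine.FunctionField)
    (Q := (E.baseChange K).toAffine.FunctionField)
    (nonZeroDivisors_le_comap_nonZeroDivisors_of_injective _
      (Affine.CoordinateRing.map_injective (algebraMap k K).injective)) a

lemma coordinateRingMap_smul (p : k[X]) (a : E.toAffine.CoordinateRing) :
    coordinateRingMap K E (p • a) = p.map (algebraMap k K) • coordinateRingMap K E a :=
  Affine.CoordinateRing.map_smul ..

lemma coordinateRingMap_mk (p : k[X][X]) :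
    coordinateRingMap K E (Affine.CoordinateRing.mk E.toAffine p) =
      Affine.CoordinateRing.mk (E.baseChange K).toAffine
        (p.map (mapRingHom (algebraMap k K))) :=
  Affine.CoordinateRing.map_mk ..

lemma repr_coordinateRingMap (a : E.toAffine.CoordinateRing) (i : Fin 2) :
    (Affine.CoordinateRing.basis (E.baseChange K).toAffine).repr (coordinateRingMap K E a) i =
      ((Affine.CoordinateRing.basis E.toAffine).repr a i).map (algebraMap k K) := by
  have h : coordinateRingMap K E a =
      ((Affine.CoordinateRing.basis E.toAffine).repr a 0).map (algebraMap k K) •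
        Affine.CoordinateRing.basis (E.baseChange K).toAffine 0 +
      ((Affine.CoordinateRing.basis E.toAffine).repr a 1).map (algebraMap k K) •
        Affine.CoordinateRing.basis (E.baseChange K).toAffine 1 := by
    conv_lhs => rw [← repr_smul_basis a]
    rw [map_add, coordinateRingMap_smul, coordinateRingMap_smul, map_one,
      coordinateRingMap_mk, Polynomial.map_X, Affine.CoordinateRing.basis_zero,
      Affine.CoordinateRing.basis_one]
  rw [h, map_add, map_smul, map_smul, Module.Basis.repr_self, Module.Basis.repr_self]
  fin_cases i <;> simp

/-- Apply a linear functional of the base change to the coordinate ring. -/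
def coordinateRingFunctional (l : K →ₗ[k] k) :
    (E.baseChange K).toAffine.CoordinateRing →+ E.toAffine.CoordinateRing where
  toFun z := coeffMap l.toAddMonoidHom
      ((Affine.CoordinateRing.basis (E.baseChange K).toAffine).repr z 0) •
        Affine.CoordinateRing.basis E.toAffine 0 +
    coeffMap l.toAddMonoidHom
      ((Affine.CoordinateRing.basis (E.baseChange K).toAffine).repr z 1) •
        Affine.CoordinateRing.basis E.toAffine 1
  map_zero' := by simp
  map_add' z w := by
    simp only [map_add, Finsupp.add_apply, add_smul]
    abel

lemma repr_coordinateRingFunctional (l : K →ₗ[k] k)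
    (z : (E.baseChange K).toAffine.CoordinateRing) (i : Fin 2) :
    (Affine.CoordinateRing.basis E.toAffine).repr (coordinateRingFunctional E l z) i =
      coeffMap l.toAddMonoidHom
        ((Affine.CoordinateRing.basis (E.baseChange K).toAffine).repr z i) := by
  rw [coordinateRingFunctional, AddMonoidHom.coe_mk, ZeroHom.coe_mk, map_add, map_smul, map_smul,
    Module.Basis.repr_self, Module.Basis.repr_self]
  fin_cases i <;> simp

lemma coordinateRingFunctional_smul (l : K →ₗ[k] k) (c : K) (a : E.toAffine.CoordinateRing) :
    coordinateRingFunctional E l (c • coordinateRingMap K E a) = l c • a := by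
  refine (Affine.CoordinateRing.basis E.toAffine).repr.injective (Finsupp.ext fun i => ?_)
  rw [repr_coordinateRingFunctional, repr_C_smul, repr_coordinateRingMap, repr_C_smul]
  ext n
  rw [coeff_coeffMap, coeff_smul, coeff_map, coeff_smul, smul_eq_mul, smul_eq_mul, mul_comm c,
    ← Algebra.smul_def]
  exact (l.map_smul _ _).trans (mul_comm _ _)

/-- The coordinate ring over K is spanned over K by the one over k. -/
lemma coordinateRing_induction {p : (E.baseChange K).toAffine.CoordinateRing → Prop}
    (hadd : ∀ z w, p z → p w → p (z + w))
    (hsmul : ∀ (c : K) (a : E.toAffine.CoordinateRing), p (c • coordinateRingMap K E a))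
    (z : (E.baseChange K).toAffine.CoordinateRing) : p z := by
  have key (q : K[X]) (a : E.toAffine.CoordinateRing) : p (q • coordinateRingMap K E a) := by
    induction q using Polynomial.induction_on' with
    | add q r hq hr =>
      rw [add_smul]
      exact hadd _ _ hq hr
    | monomial n c =>
      have : (monomial n c : K[X]) • coordinateRingMap K E a =
          c • coordinateRingMap K E ((X ^ n : k[X]) • a) := by
        rw [coordinateRingMap_smul, Polynomial.map_pow, Polynomial.map_X,
          ← C_mul_X_pow_eq_monomial, mul_smul]
        exact algebraMap_smul K[X] c _
      rw [this]
      exact hsmul _ _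
  rw [← repr_smul_basis z]
  refine hadd _ _ ?_ ?_
  · simpa using key _ 1
  · have h := key ((Affine.CoordinateRing.basis (E.baseChange K).toAffine).repr z 1)
      (Affine.CoordinateRing.mk E.toAffine X)
    rwa [coordinateRingMap_mk, Polynomial.map_X] at h

/-- Linearity over the coordinate ring of E: a linear relation with coefficients over k survives the
functional. -/
lemma coordinateRingFunctional_mul (l : K →ₗ[k] k) (a : E.toAffine.CoordinateRing)
    (z : (E.baseChange K).toAffine.CoordinateRing) :
    coordinateRingFunctional E l (coordinateRingMap K E a * z) =
      a * coordinateRingFunctional E l z := by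
  induction z using coordinateRing_induction with
  | hadd z w hz hw => rw [mul_add, map_add, map_add, hz, hw, mul_add]
  | hsmul c b =>
    rw [mul_smul_comm, ← map_mul, coordinateRingFunctional_smul, coordinateRingFunctional_smul,
      mul_smul_comm]

/-- Some coefficient is nonzero, and functionals separate the vectors of K over k. -/
lemma exists_coordinateRingFunctional_ne_zero {z : (E.baseChange K).toAffine.CoordinateRing}
    (hz : z ≠ 0) : ∃ l : K →ₗ[k] k, coordinateRingFunctional E l z ≠ 0 := by
  have : ∃ i n, ((Affine.CoordinateRing.basis (E.baseChange K).toAffine).repr z i).coeff n ≠ 0 := by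
    by_contra! h
    refine hz ((Affine.CoordinateRing.basis (E.baseChange K).toAffine).repr.injective
      (Finsupp.ext fun i => Polynomial.ext fun n => ?_))
    rw [h, map_zero]
    rfl
  obtain ⟨i, n, hin⟩ := this
  obtain ⟨l, hl⟩ := Module.Projective.exists_dual_ne_zero k hin
  refine ⟨l, fun h0 => hl ?_⟩
  have h1 := repr_coordinateRingFunctional E l z i
  rw [h0, map_zero] at h1
  exact (coeff_coeffMap _ _ n).symm.trans (congrArg (coeff · n) h1.symm)

/-- Applying a functional does not raise the order of the pole at infinity. -/
lemma val_zero_coordinateRingFunctional_le (l : K →ₗ[k] k)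
    (z : (E.baseChange K).toAffine.CoordinateRing) :
    inftyIntValuation (E.baseChange K).toAffine
        (coordinateRingMap K E (coordinateRingFunctional E l z)) ≤
      inftyIntValuation (E.baseChange K).toAffine z := by
  by_cases hz : z = 0
  · rw [hz, map_zero, map_zero]
  rw [inftyIntValuation_apply hz]
  have h1 (b : (E.baseChange K).toAffine.CoordinateRing) (m : ℕ) :
      inftyIntValuation _ b ≤ exp (m : ℤ) ↔ inftyIntValuation _ b < exp ((m + 1 : ℕ) : ℤ) := by
    by_cases hb : b = 0
    · simp [hb]
    · rw [inftyIntValuation_apply hb, exp_lt_exp, exp_le_exp]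
      lia
  rw [h1, inftyIntValuation_lt_exp_iff, degree_norm_lt_iff]
  have h2 := (h1 z _).mp (inftyIntValuation_apply hz).le
  rw [inftyIntValuation_lt_exp_iff, degree_norm_lt_iff] at h2
  refine ⟨fun i hi => ?_, fun i hi => ?_⟩
  · rw [repr_coordinateRingMap, repr_coordinateRingFunctional, coeff_map, coeff_coeffMap,
      h2.1 i hi, map_zero, map_zero]
  · rw [repr_coordinateRingMap, repr_coordinateRingFunctional, coeff_map, coeff_coeffMap,
      h2.2 i hi, map_zero, map_zero]

end CoefficientFunctional

section Descent

variable {K : Type*} [Field K] {W : Affine K} [IsAlgClosed K] [W.IsElliptic]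

lemma exists_algebraMap_eq {g : W.FunctionField} (hg : ∀ P ≠ 0, val P g ≤ 1) :
    ∃ a, algebraMap W.CoordinateRing W.FunctionField a = g := by
  refine HeightOneSpectrum.mem_integers_of_valuation_le_one W.FunctionField g fun v => ?_
  obtain ⟨x, y, h, rfl⟩ := exists_eq_place v
  exact hg _ (Affine.Point.some_ne_zero h)

/-- Two functions have the same divisor if one has everywhere at least the order of the other. -/
lemma ord_eq_of_le [CharZero K] {g h : W.FunctionField} (hg : g ≠ 0) (hh : h ≠ 0)
    (hle : ∀ P, ord P g ≤ ord P h) (P : W.Point) : ord P g = ord P h := by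
  -- h / g has an effective divisor of degree zero, which must vanish.
  have hq := mul_ne_zero hh (inv_ne_zero hg)
  have hord (Q : W.Point) : ord Q (h * g⁻¹) = ord Q h - ord Q g := by
    rw [ord_mul Q hh (inv_ne_zero hg), ord_inv Q hg, sub_eq_add_neg]
  have hsum := sum_divisor hq
  have hnn (Q : W.Point) : 0 ≤ divisor hq Q := by
    rw [divisor_apply, hord, sub_nonneg]
    exact hle Q
  rw [Finsupp.sum, Finset.sum_eq_zero_iff_of_nonneg fun Q _ => hnn Q] at hsum
  have h0 : divisor hq P = 0 := by
    by_contra h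
    exact h (hsum P (Finsupp.mem_support_iff.mpr h))
  rw [divisor_apply, hord, sub_eq_zero] at h0
  exact h0.symm

variable {k : Type*} [Field k] [Algebra k K] [CharZero K] (E : WeierstrassCurve k) [E.IsElliptic]

instance : (E.baseChange K).toAffine.IsElliptic :=
  inferInstanceAs (E.map (algebraMap k K)).IsElliptic

/-- A function whose divisor outside the origin is the polar divisor of a function over `k` may be
replaced by a function over `k`. -/
lemma exists_functionFieldMap_ord_eq {g : (E.baseChange K).toAffine.FunctionField} (hg : g ≠ 0)
    {u : E.toAffine.FunctionField} (hu : functionFieldMap K E u ≠ 0)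
    (h : ∀ P ≠ 0, ord P g = max 0 (-ord P (functionFieldMap K E u))) :
    ∃ b : E.toAffine.FunctionField, functionFieldMap K E b ≠ 0 ∧
      ∀ P, ord P (functionFieldMap K E b) = ord P g := by
  have hinj := IsFractionRing.injective (E.baseChange K).toAffine.CoordinateRing
    (E.baseChange K).toAffine.FunctionField
  have hinj' : Function.Injective (coordinateRingMap K E) :=
    Affine.CoordinateRing.map_injective (algebraMap k K).injective
  obtain ⟨z, rfl⟩ := exists_algebraMap_eq (g := g) fun P hP =>
    (ord_nonneg_iff hg).mp (by rw [h P hP]; exact le_max_left _ _)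
  -- The zeros of z absorb the poles of u away from O, so z u is again in the coordinate ring. With
  -- u = p / q this is the relation p z = q r, whose coefficients p and q are over k.
  obtain ⟨r, hr⟩ := exists_algebraMap_eq (g := algebraMap _ _ z * functionFieldMap K E u)
    fun P hP => (ord_nonneg_iff (mul_ne_zero hg hu)).mp (by
      rw [ord_mul P hg hu, h P hP]
      exact neg_le_iff_add_nonneg.mp (le_max_right _ _))
  obtain ⟨p, q, hq, rfl⟩ := IsFractionRing.div_surjective (A := E.toAffine.CoordinateRing) u
  have hq0 : q ≠ 0 := nonZeroDivisors.ne_zero hq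
  have hq' : algebraMap _ (E.baseChange K).toAffine.FunctionField (coordinateRingMap K E q) ≠ 0 :=
    (map_ne_zero_iff _ hinj).mpr ((map_ne_zero_iff _ hinj').mpr hq0)
  have hz0 : z ≠ 0 := by
    rintro rfl
    exact hg (map_zero _)
  obtain ⟨l, hl⟩ := exists_coordinateRingFunctional_ne_zero E hz0
  rw [map_div₀, functionFieldMap_algebraMap, functionFieldMap_algebraMap] at hr hu h
  have hzr : coordinateRingMap K E p * z = coordinateRingMap K E q * r := by
    apply hinj
    rw [map_mul, map_mul, hr]
    field_simp
  -- The functional gives l(z) u = l(r), so l(z) also absorbs the poles of u.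
  have hlr := congrArg (coordinateRingFunctional E l) hzr
  rw [coordinateRingFunctional_mul, coordinateRingFunctional_mul] at hlr
  have hb0 : algebraMap _ (E.baseChange K).toAffine.FunctionField
      (coordinateRingMap K E (coordinateRingFunctional E l z)) ≠ 0 :=
    (map_ne_zero_iff _ hinj).mpr ((map_ne_zero_iff _ hinj').mpr hl)
  refine ⟨algebraMap _ _ (coordinateRingFunctional E l z), ?_, fun P => ?_⟩
  · rwa [functionFieldMap_algebraMap]
  rw [functionFieldMap_algebraMap]
  -- It suffices that l(z) vanishes at least as much as z everywhere: at O because the functional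
  -- does not raise pole orders, elsewhere because ord z is the least order that absorbs the poles
  -- of u.
  refine (ord_eq_of_le hg hb0 (fun Q => ?_) P).symm
  by_cases hQ : Q = 0
  · subst hQ
    rw [ord_eq _ hg, ord_eq _ hb0, neg_le_neg_iff, log_le_log ((Valuation.ne_zero_iff _).mpr hb0)
      ((Valuation.ne_zero_iff _).mpr hg), val_zero, inftyValuation_algebraMap,
      inftyValuation_algebraMap]
    exact val_zero_coordinateRingFunctional_le E l z
  · rw [h Q hQ]
    refine max_le ((ord_nonneg_iff hb0).mpr (val_algebraMap_le_one hQ _)) ?_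
    have he : algebraMap _ (E.baseChange K).toAffine.FunctionField
          (coordinateRingMap K E (coordinateRingFunctional E l z)) *
        (algebraMap _ _ (coordinateRingMap K E p) / algebraMap _ _ (coordinateRingMap K E q)) =
        algebraMap _ _ (coordinateRingMap K E (coordinateRingFunctional E l r)) := by
      rw [← mul_div_assoc, div_eq_iff hq', ← map_mul, ← map_mul, ← map_mul, ← map_mul,
        mul_comm _ p, hlr, mul_comm]
    have hn := mul_ne_zero hb0 hu
    have h2 : 0 ≤ ord Q _ := (ord_nonneg_iff hn).mpr (by
      rw [he]
      exact val_algebraMap_le_one hQ _)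
    rw [ord_mul Q hb0 hu] at h2
    exact neg_le_iff_add_nonneg.mpr h2

end Descent

end

end EllipticIsogeny

namespace EllipticIsogeny

open WeierstrassCurve Polynomial IsDedekindDomain nonZeroDivisors WithZero

noncomputable section

/-! ### Linear equivalence over k -/

section FieldOfDefinition

variable {k K : Type*} [Field k] [Field K] [Algebra k K]

lemma functionFieldMap_xFun (E : WeierstrassCurve k) :
    functionFieldMap K E (xFun E.toAffine) = xFun (E.baseChange K).toAffine := by
  rw [xFun, functionFieldMap_algebraMap, coordinateRingMap_mk]
  simp [xFun]

lemma functionFieldMap_yFun (E : WeierstrassCurve k) :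
    functionFieldMap K E (yFun E.toAffine) = yFun (E.baseChange K).toAffine := by
  rw [yFun, functionFieldMap_algebraMap, coordinateRingMap_mk]
  simp [yFun]

lemma LinEquivOver.linEquiv {E : WeierstrassCurve k} {D D' : Divisor (E.baseChange K).toAffine}
    (h : LinEquivOver D D') : LinEquiv D D' :=
  let ⟨_, hg⟩ := h
  ⟨_, hg⟩

variable [IsAlgClosed K]

lemma ord_pow {W : Affine K} [W.IsElliptic] (P : W.Point) {g : W.FunctionField} (hg : g ≠ 0)
    (n : ℕ) : ord P (g ^ n) = n * ord P g := by
  rw [ord_eq P hg, ord_eq P (pow_ne_zero n hg), map_pow, log_pow, nsmul_eq_mul, mul_neg]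

/-- Away from O, the zeros of g are the points of the kernel, all simple. If u is over k with a pole
of order m at O and no other, then f^*u is over k and has poles of order m exactly on the kernel, so
g^m can be replaced by a function over k. A simple pole, m = 1, is not available; the orders 2 of x
and 3 of y are. -/
lemma Isogeny.linEquivOver_pullback [CharZero K] [DecidableEq K] {E E' : WeierstrassCurve k}
    [E.IsElliptic] [E'.IsElliptic] (f : Isogeny (E.baseChange K).toAffine (E'.baseChange K).toAffine)
    (hf : f.DefinedOver) {n : ℕ}
    (h : LinEquiv (f.pullback (Finsupp.single 0 1)) (n • Finsupp.single 0 1)) :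
    LinEquivOver (f.pullback (Finsupp.single 0 1)) (n • Finsupp.single 0 1) := by
  classical
  obtain ⟨g, hg, hgD⟩ := h
  have hord (P : (E.baseChange K).toAffine.Point) (hP : P ≠ 0) :
      ord P g = if f.toFun P = 0 then 1 else 0 := by
    rw [hgD, Finsupp.sub_apply, f.pullback_apply, Finsupp.smul_apply,
      Finsupp.single_eq_of_ne hP, smul_zero, sub_zero, Finsupp.single_apply]
    split_ifs with h1 h2 h2
    · rw [f.ramificationIndex_of_mem_ker h2, mul_one]
    · exact (h2 h1.symm).elim
    · exact (h1 h2.symm).elim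
    · rw [mul_zero]
  have key (u : E'.toAffine.FunctionField) (m : ℕ)
      (hu : val 0 (functionFieldMap K E' u) = exp (m : ℤ))
      (hu' : ∀ P ≠ 0, val P (functionFieldMap K E' u) ≤ 1) :
      ∃ b : E.toAffine.FunctionField, functionFieldMap K E b ≠ 0 ∧
        ∀ P, ord P (functionFieldMap K E b) = m * ord P g := by
    have hu0 : functionFieldMap K E' u ≠ 0 :=
      (Valuation.ne_zero_iff _).mp (hu.trans_ne exp_ne_zero)
    obtain ⟨v, hv⟩ := hf u
    have hv0 : functionFieldMap K E v ≠ 0 :=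
      hv ▸ (map_ne_zero_iff _ f.comap.injective).mpr hu0
    obtain ⟨b, hb0, hb⟩ := exists_functionFieldMap_ord_eq E (pow_ne_zero m hg) hv0 fun P hP => by
      rw [ord_pow P hg, hord P hP, ← hv, f.ord_comap P hu0]
      split_ifs with h0
      · rw [f.ramificationIndex_of_mem_ker h0, h0, ord_eq _ hu0, hu, log_exp, one_mul, neg_neg,
          mul_one, max_eq_right (Nat.cast_nonneg m)]
      · rw [mul_zero, max_eq_left]
        exact neg_nonpos.mpr (mul_nonneg (f.ramificationIndex_pos P).le
          ((ord_nonneg_iff hu0).mpr (hu' _ h0)))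
    exact ⟨b, hb0, fun P => by rw [hb, ord_pow P hg]⟩
  obtain ⟨b, hb0, hb⟩ := key (xFun E'.toAffine) 2
    (by rw [functionFieldMap_xFun]; exact val_xFun_zero) fun P hP => by
      rw [functionFieldMap_xFun]
      exact val_algebraMap_le_one hP _
  obtain ⟨c, hc0, hc⟩ := key (yFun E'.toAffine) 3
    (by rw [functionFieldMap_yFun]; exact val_yFun_zero) fun P hP => by
      rw [functionFieldMap_yFun]
      exact val_algebraMap_le_one hP _
  -- The divisors of c and b are 3 and 2 times that of g.
  refine ⟨c * b⁻¹, ?_, fun P => ?_⟩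
  · rw [map_mul, map_inv₀]
    exact mul_ne_zero hc0 (inv_ne_zero hb0)
  · rw [map_mul, map_inv₀, ord_mul P hc0 (inv_ne_zero hb0), ord_inv P hb0, hb, hc, ← hgD P]
    push_cast
    ring

end FieldOfDefinition

end

end EllipticIsogeny

theorem mainTheorem3 {k : Type*} [Field k] [CharZero k] {K : Type*} [Field K] [DecidableEq K]
    [Algebra k K] [IsAlgClosure k K] (E : WeierstrassCurve k) [E.IsElliptic]
    (f : EllipticIsogeny.Isogeny (E.baseChange K).toAffine (E.baseChange K).toAffine) (d : ℕ)
    (hd : f.degree = d) :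
    ((({P | 2 • P = 0} ∩ f.ker).ncard ≠ 2) ↔
      EllipticIsogeny.LinEquiv (f.pullback (Finsupp.single 0 1)) (d • Finsupp.single 0 1)) ∧
    (f.DefinedOver →
      ((({P | 2 • P = 0} ∩ f.ker).ncard ≠ 2) ↔
        EllipticIsogeny.LinEquivOver (f.pullback (Finsupp.single 0 1))
          (d • Finsupp.single 0 1))) := by
  have : IsAlgClosed K := IsAlgClosure.isAlgClosed k
  have : CharZero K := charZero_of_injective_algebraMap (algebraMap k K).injective
  have h : ({P | 2 • P = 0} ∩ f.ker).ncard ≠ 2 ↔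
      EllipticIsogeny.LinEquiv (f.pullback (Finsupp.single 0 1)) (d • Finsupp.single 0 1) := by
    rw [← hd, f.linEquiv_pullback_iff]
    exact f.ncard_two_torsion_ne_two_iff
  exact ⟨h, fun hf => ⟨fun h2 => f.linEquivOver_pullback hf (h.mp h2), fun h2 =>
    h.mpr h2.linEquiv⟩⟩
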